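/- Let $R$ be a commutative ring and $S\subset R$ a multiplicative subset such that the $R$-module $S^{-1}R$ has projective dimension at most $1$. Let $\star\in\{\mathsf b,+,-,\varnothing\}$, and let $\mathsf D^\star(R\text{-}\mathrm{mod})$ denote the bounded, bounded below, bounded above, or unbounded derived category of $R$-modules, respectively (and similarly for $S^{-1}R$). An $R$-module $M$ is called $S$-torsion if every element of $M$ is annihilated by some element of $S$; an $R$-module $C$ is called an $S$-contramodule if $\operatorname{Hom}_R(S^{-1}R,C)=0=\operatorname{Ext}^1_R(S^{-1}R,C)$. Let $\mathsf D^\star_{S\text{-}\mathrm{tors}}(R\text{-}\mathrm{mod})$ and $\mathsf D^\star_{S\text{-}\mathrm{ctra}}(R\text{-}\mathrm{mod})$ be the full triangulated subcategories of $\mathsf D^\star(R\text{-}\mathrm{mod})$ formed by the complexes whose cohomology modules are $S$-torsion modules, respectively $S$-contramodules. Let $k_*\colon\mathsf D^\star(S^{-1}R\text{-}\mathrm{mod})\to\mathsf D^\star(R\text{-}\mathrm{mod})$ be the functor of restriction of scalars. Choose a projective resolution $0\to\overline T^0\to\overline T^1\to S^{-1}R\to 0$ of the $R$-module $S^{-1}R$,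 and lift the localization map $R\to S^{-1}R$ to an $R$-module map $R\to\overline T^1$; let $T^\bullet$ be the two-term complex $R\oplus\overline T^0\to\overline T^1$ in cohomological degrees $0$ and $1$. For a complex of $R$-modules $M^\bullet$, let $\operatorname{Hom}_R(T^\bullet,M^\bullet)$ be the total complex of homomorphisms, and let $\check C^\bullet(M^\bullet)^\sim$ be the total complex of the two-row bicomplex $M^\bullet\to S^{-1}R\otimes_RM^\bullet$ with $M^\bullet$ in row $0$ and $S^{-1}R\otimes_RM^\bullet$ in row $1$. Then: 1. The functor $k_*$ is fully faithful, and its essential image is a thick subcategory (a triangulated subcategory closed under direct summands) of $\mathsf D^\star(R\text{-}\mathrm{mod})$. 2. The compositions of the inclusions of $\mathsf D^\star_{S\text{-}\mathrm{tors}}(R\text{-}\mathrm{mod})$ and of $\mathsf D^\star_{S\text{-}\mathrm{ctra}}(R\text{-}\mathrm{mod})$ into $\mathsf D^\star(R\text{-}\mathrm{mod})$ with the Verdier quotient functor are equivalences of triangulated categories $$\mathsf D^\star_{S\text{-}\mathrm{tors}}(R\text{-}\mathrm{mod})\simeq\mathsf D^\star(R\text{-}\mathrm{mod})/\mathsf D^\star(S^{-1}R\text{-}\mathrm{mod})\simeq\mathsf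 D^\star_{S\text{-}\mathrm{ctra}}(R\text{-}\mathrm{mod}).$$ 3. The resulting triangulated equivalence $\mathsf D^\star_{S\text{-}\mathrm{tors}}(R\text{-}\mathrm{mod})\simeq\mathsf D^\star_{S\text{-}\mathrm{ctra}}(R\text{-}\mathrm{mod})$ takes a complex $M^\bullet\in\mathsf D^\star_{S\text{-}\mathrm{tors}}(R\text{-}\mathrm{mod})$ to $\operatorname{Hom}_R(T^\bullet,M^\bullet)$, for every choice of $T^\bullet$ as above, and its quasi-inverse takes a complex $A^\bullet\in\mathsf D^\star_{S\text{-}\mathrm{ctra}}(R\text{-}\mathrm{mod})$ to $\check C^\bullet(A^\bullet)^\sim$, naturally in $M^\bullet$ and $A^\bullet$. -/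

import Mathlib

open CategoryTheory Limits Pretriangulated ZeroObject

universe w w' v v' u u'

namespace TriangulatedMatlis

/-! ### Bounded versions of the derived category -/

/-- The conventional derived category symbols `b`, `+`, `-` and the empty symbol. -/
inductive Bdd : Type
  | b
  | plus
  | minus
  | none

/-- If `P` is closed under kernels, cokernels and extensions, then the middle term of a five term
exact sequence has the property `P` as soon as the other terms have it. -/
lemma prop_of_exact {C : Type u} [Category.{v} C] [Abelian C] (P : ObjectProperty C) [P.IsClosedUnderKernels] [P.IsClosedUnderCokernels]
    [P.IsClosedUnderExtensions] {X₁ X₂ X₃ X₄ X₅ : C} {f : X₁ ⟶ X₂} {g : X₂ ⟶ X₃} {h : X₃ ⟶ X₄}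
    {k : X₄ ⟶ X₅} {w₁ : f ≫ g = 0} {w₂ : g ≫ h = 0} {w₃ : h ≫ k = 0}
    (e₁ : (ShortComplex.mk f g w₁).Exact) (e₂ : (ShortComplex.mk g h w₂).Exact)
    (e₃ : (ShortComplex.mk h k w₃).Exact) (h₁ : P X₁) (h₂ : P X₂) (h₄ : P X₄) (h₅ : P X₅) :
    P X₃ := by
  have w₄ : cokernel.desc f g w₁ ≫ kernel.lift k h w₃ = 0 := by
    rw [← cancel_epi (cokernel.π f), ← cancel_mono (kernel.ι k)]
    simp [w₂]
  have m : Mono (cokernel.desc f g w₁) := e₁.mono_cokernelDesc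
  have p : Epi (kernel.lift k h w₃) := e₃.epi_kernelLift
  have e₄ : (ShortComplex.mk _ _ w₄).Exact := by
    let φ : ShortComplex.mk g h w₂ ⟶ ShortComplex.mk (cokernel.desc f g w₁) h (by
        rw [← cancel_epi (cokernel.π f)]; simp [w₂]) :=
      { τ₁ := cokernel.π f, τ₂ := 𝟙 _, τ₃ := 𝟙 _ }
    let ψ : ShortComplex.mk _ _ w₄ ⟶ ShortComplex.mk (cokernel.desc f g w₁) h (by
        rw [← cancel_epi (cokernel.π f)]; simp [w₂]) :=
      { τ₁ := 𝟙 _, τ₂ := 𝟙 _, τ₃ := kernel.ι k }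
    have : Epi φ.τ₁ := inferInstanceAs (Epi (cokernel.π f))
    have : IsIso φ.τ₂ := inferInstanceAs (IsIso (𝟙 _))
    have : Mono φ.τ₃ := inferInstanceAs (Mono (𝟙 _))
    have : Epi ψ.τ₁ := inferInstanceAs (Epi (𝟙 _))
    have : IsIso ψ.τ₂ := inferInstanceAs (IsIso (𝟙 _))
    have : Mono ψ.τ₃ := inferInstanceAs (Mono (kernel.ι k))
    exact (ShortComplex.exact_iff_of_epi_of_isIso_of_mono ψ).2
      ((ShortComplex.exact_iff_of_epi_of_isIso_of_mono φ).1 e₂)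
  exact P.prop_X₂_of_shortExact (ShortComplex.ShortExact.mk e₄)
    (P.prop_cokernel f h₁ h₂) (P.prop_kernel k h₄ h₅)

section DerivedCategories

variable {C : Type u} [Category.{v} C] [Abelian C] [HasDerivedCategory.{w} C]

/-- The objects of the unbounded derived category that are represented by bounded, bounded below,
bounded above or arbitrary complexes. -/
noncomputable def Bdd.prop (s : Bdd) : ObjectProperty (DerivedCategory.{w} C) :=
  match s with
  | .b => DerivedCategory.TStructure.t.bounded
  | .plus => DerivedCategory.TStructure.t.plus
  | .minus => DerivedCategory.TStructure.t.minus
  | .none => ⊤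

instance (s : Bdd) : (s.prop (C := C)).IsTriangulated := by
  cases s <;> dsimp only [Bdd.prop]
  · infer_instance
  · infer_instance
  · infer_instance
  · exact { exists_zero := ⟨0, isZero_zero _, trivial⟩
            isStableUnderShiftBy := fun _ => ⟨fun _ _ => trivial⟩
            ext₂' := fun T _ _ _ => ObjectProperty.le_isoClosure _ _ trivial }

instance (s : Bdd) : (s.prop (C := C)).IsClosedUnderIsomorphisms := by
  cases s <;> dsimp only [Bdd.prop] <;> infer_instance

variable (C) in
/-- The derived category `D^⋆(C)`, a full triangulated subcategory of `D(C)`. -/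
abbrev DStar (s : Bdd) := (s.prop (C := C)).FullSubcategory

/-- The objects of `D^⋆(C)` all of whose cohomology objects have the property `P`. -/
def hasCohomology (s : Bdd) (P : ObjectProperty C) : ObjectProperty (DStar.{w} C s) :=
  fun X => ∀ n : ℤ, P ((DerivedCategory.homologyFunctor C n).obj X.obj)

instance (s : Bdd) (P : ObjectProperty C) [P.IsClosedUnderIsomorphisms] :
    (hasCohomology.{w} s P).IsClosedUnderIsomorphisms where
  of_iso e h n :=
    P.prop_of_iso ((s.prop.ι ⋙ DerivedCategory.homologyFunctor C n).mapIso e) (h n)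

lemma hasCohomology_isTriangulated (s : Bdd) (P : ObjectProperty C) [P.ContainsZero]
    [P.IsClosedUnderIsomorphisms] [P.IsClosedUnderKernels] [P.IsClosedUnderCokernels]
    [P.IsClosedUnderExtensions] : (hasCohomology.{w} s P).IsTriangulated where
  exists_zero := by
    refine ⟨0, isZero_zero _, fun n => ?_⟩
    exact P.prop_of_isZero
      ((s.prop.ι ⋙ DerivedCategory.homologyFunctor C n).map_isZero (isZero_zero _))
  isStableUnderShiftBy a := by
    refine ⟨fun X hX n => ?_⟩
    have e : (DerivedCategory.homologyFunctor C (a + n)).obj X.obj ≅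
        (DerivedCategory.homologyFunctor C n).obj ((s.prop.ι).obj (X⟦a⟧)) :=
      ((DerivedCategory.homologyFunctor C 0).shiftIso a n (a + n) rfl).symm.app X.obj ≪≫
        (DerivedCategory.homologyFunctor C n).mapIso ((s.prop.ι.commShiftIso a).symm.app X)
    exact P.prop_of_iso e (hX (a + n))
  toIsTriangulatedClosed₂ := .mk' (fun T hT h₁ h₃ n => by
    have hT' := s.prop.ι.map_distinguished T hT
    exact prop_of_exact P
      (DerivedCategory.HomologySequence.exact₁ _ hT' (n - 1) n (by lia))
      (DerivedCategory.HomologySequence.exact₂ _ hT' n)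
      (DerivedCategory.HomologySequence.exact₃ _ hT' n (n + 1) rfl)
      (h₃ (n - 1)) (h₁ n) (h₃ n) (h₁ (n + 1)))

end DerivedCategories

/-! ### Exact functors and `D^⋆` -/

section Restriction

variable {C : Type u} [Category.{v} C] [Abelian C] [HasDerivedCategory.{w} C]
  {D : Type u'} [Category.{v'} D] [Abelian D] [HasDerivedCategory.{w'} D]
  (F : C ⥤ D) [F.Additive] [PreservesFiniteLimits F] [PreservesFiniteColimits F]

lemma prop_mapDerivedCategory (s : Bdd) (X : DStar.{w} C s) :
    s.prop (F.mapDerivedCategory.obj X.obj) := by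
  have hp : ∀ X : DerivedCategory C, DerivedCategory.TStructure.t.plus X →
      DerivedCategory.TStructure.t.plus (F.mapDerivedCategory.obj X) := by
    rintro X ⟨n, K, e, hK⟩
    refine ⟨n, (F.mapHomologicalComplex _).obj K,
      F.mapDerivedCategory.mapIso e ≪≫ F.mapDerivedCategoryFactors.app K, ?_⟩
    rw [CochainComplex.isStrictlyGE_iff]
    exact fun i hi => F.map_isZero (K.isZero_of_isStrictlyGE n i hi)
  have hm : ∀ X : DerivedCategory C, DerivedCategory.TStructure.t.minus X →
      DerivedCategory.TStructure.t.minus (F.mapDerivedCategory.obj X) := by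
    rintro X ⟨n, K, e, hK⟩
    refine ⟨n, (F.mapHomologicalComplex _).obj K,
      F.mapDerivedCategory.mapIso e ≪≫ F.mapDerivedCategoryFactors.app K, ?_⟩
    rw [CochainComplex.isStrictlyLE_iff]
    exact fun i hi => F.map_isZero (K.isZero_of_isStrictlyLE n i hi)
  obtain ⟨X, hX⟩ := X
  cases s
  · exact ⟨hp X hX.1, hm X hX.2⟩
  · exact hp X hX
  · exact hm X hX
  · trivial

/-- The functor `D^⋆(C) ⥤ D^⋆(D)` induced by an exact functor `C ⥤ D`. -/
noncomputable abbrev mapDStar (s : Bdd) : DStar.{w} C s ⥤ DStar.{w'} D s :=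
  s.prop.lift (s.prop.ι ⋙ F.mapDerivedCategory) (prop_mapDerivedCategory F s)

end Restriction

section Modules

variable {R : Type u} [CommRing R] (S : Submonoid R)

/-- The `R`-module `S⁻¹R`. -/
abbrev loc : ModuleCat.{u} R := ModuleCat.of R (Localization S)

/-- `S`-torsion modules: every element is annihilated by an element of `S`. -/
def tors : ObjectProperty (ModuleCat.{u} R) := fun M => ∀ x : M, ∃ s ∈ S, s • x = 0

/-- `S`-contramodules: the modules `C` with `Ext^n_R(S⁻¹R, C) = 0` for `n = 0` and `n = 1`. -/
def ctra : ObjectProperty (ModuleCat.{u} R) :=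
  fun M => ∀ n : ℕ, n ≤ 1 → Subsingleton (Abelian.Ext (loc S) M n)

instance : (tors S).ContainsZero where
  exists_zero := ⟨0, isZero_zero _, fun x =>
    ⟨1, S.one_mem, by
      have := ModuleCat.subsingleton_of_isZero (isZero_zero (ModuleCat.{u} R))
      exact Subsingleton.elim _ _⟩⟩

instance : (tors S).IsClosedUnderSubobjects where
  prop_of_mono f _ h x := by
    obtain ⟨s, hs, e⟩ := h (f x)
    refine ⟨s, hs, (ModuleCat.mono_iff_injective f).1 inferInstance ?_⟩
    rw [map_smul, e, map_zero]

instance : (tors S).IsClosedUnderQuotients where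
  prop_of_epi f _ h y := by
    obtain ⟨x, rfl⟩ := (ModuleCat.epi_iff_surjective f).1 inferInstance y
    obtain ⟨s, hs, e⟩ := h x
    exact ⟨s, hs, by rw [← map_smul, e, map_zero]⟩

instance : (tors S).IsClosedUnderExtensions where
  prop_X₂_of_shortExact {T} hT h₁ h₃ x := by
    obtain ⟨s, hs, e⟩ := h₃ (T.g x)
    have hx : T.g (s • x) = 0 := by rw [map_smul, e]
    obtain ⟨y, hy⟩ := (ShortComplex.moduleCat_exact_iff _).1 hT.exact (s • x) hx
    obtain ⟨t, ht, e'⟩ := h₁ y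
    exact ⟨t * s, S.mul_mem ht hs, by rw [mul_smul, ← hy, ← map_smul, e', map_zero]⟩

instance : (ctra S).ContainsZero where
  exists_zero := ⟨0, isZero_zero _, fun n _ => ⟨fun a b => by
    have h (x : Abelian.Ext (loc S) (0 : ModuleCat.{u} R) n) : x = 0 := by
      rw [← x.comp_mk₀_id, (isZero_zero (ModuleCat.{u} R)).eq_of_src (𝟙 0) 0]
      simp
    rw [h a, h b]⟩⟩

lemma ctra_X₁ {T : ShortComplex (ModuleCat.{u} R)} (hT : T.ShortExact)
    (h₂ : ctra S T.X₂) (h₃ : Subsingleton (Abelian.Ext (loc S) T.X₃ 0)) : ctra S T.X₁ := by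
  intro n hn
  refine subsingleton_of_forall_eq 0 fun x => ?_
  have := h₂ n hn
  have hx : x.comp (Abelian.Ext.mk₀ T.f) (add_zero n) = 0 := Subsingleton.elim _ _
  obtain rfl | rfl : n = 0 ∨ n = 1 := by lia
  · have := hT.mono_f
    exact Abelian.Ext.postcomp_mk₀_injective_of_mono (loc S) T.f
      (by simpa using hx)
  · obtain ⟨y, rfl⟩ := Abelian.Ext.covariant_sequence_exact₁ (loc S) hT x hx (zero_add 1)
    rw [Subsingleton.elim y 0, Abelian.Ext.zero_comp]

instance : (ctra S).IsClosedUnderIsomorphisms where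
  of_iso {M N} e h n hn := by
    refine subsingleton_of_forall_eq 0 fun x => ?_
    have := h n hn
    rw [← x.comp_mk₀_id, ← e.inv_hom_id, ← Abelian.Ext.mk₀_comp_mk₀,
      ← Abelian.Ext.comp_assoc_of_second_deg_zero,
      Subsingleton.elim (x.comp (Abelian.Ext.mk₀ e.inv) (add_zero n)) 0, Abelian.Ext.zero_comp]

instance : (ctra S).IsClosedUnderExtensions where
  prop_X₂_of_shortExact {T} hT h₁ h₃ n hn := by
    refine subsingleton_of_forall_eq 0 fun x => ?_
    have := h₁ n hn
    have := h₃ n hn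
    obtain ⟨y, rfl⟩ := Abelian.Ext.covariant_sequence_exact₂ (loc S) hT x (Subsingleton.elim _ _)
    rw [Subsingleton.elim y 0, Abelian.Ext.zero_comp]

lemma kernel_image_shortExact {C : Type u} [Category.{v} C] [Abelian C] {A B : C} (f : A ⟶ B) :
    (ShortComplex.mk (kernel.ι f) (Abelian.factorThruImage f)
      (by rw [← cancel_mono (Abelian.image.ι f)]; simp)).ShortExact where
  exact := ShortComplex.exact_of_f_is_kernel _
    (KernelFork.IsLimit.ofι _ _
      (fun k hk => kernel.lift f k (by rw [← Abelian.image.fac f, reassoc_of% hk, zero_comp]))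
      (fun k hk => kernel.lift_ι _ _ _)
      (fun k hk m hm => by rw [← cancel_mono (kernel.ι f)]; simpa using hm))

variable {S} in
lemma ctra_kernel {A B : ModuleCat.{u} R} (f : A ⟶ B) (hA : ctra S A) (hB : ctra S B) :
    ctra S (kernel f) := by
  refine ctra_X₁ S (kernel_image_shortExact f) hA (subsingleton_of_forall_eq 0 fun x => ?_)
  have := hB 0 (by lia)
  exact Abelian.Ext.postcomp_mk₀_injective_of_mono (loc S) (Abelian.image.ι f)
    (Subsingleton.elim _ _)

instance : (ctra S).IsClosedUnderKernels where
  kernels_le := by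
    rintro _ ⟨f, k, hk, hA, hB⟩
    exact (ctra S).prop_of_iso ((kernelIsKernel f).conePointUniqueUpToIso hk)
      (ctra_kernel f hA hB)

section Perp

/-! When `S⁻¹R` has projective dimension at most one, the contramodules are also closed under
cokernels. -/

variable [HasProjectiveDimensionLE (loc S) 1]

variable {S} in
lemma ctra_iff (M : ModuleCat.{u} R) :
    ctra S M ↔ ∀ n : ℕ, Subsingleton (Abelian.Ext (loc S) M n) := by
  refine ⟨fun h n => ?_, fun h n _ => h n⟩
  by_cases hn : n ≤ 1
  · exact h n hn
  · exact HasProjectiveDimensionLT.subsingleton (loc S) 2 n (by lia) M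

variable {S} in
lemma ctra_X₃ {T : ShortComplex (ModuleCat.{u} R)} (hT : T.ShortExact)
    (h₁ : ctra S T.X₁) (h₂ : ctra S T.X₂) : ctra S T.X₃ := by
  rw [ctra_iff] at h₁ h₂ ⊢
  intro n
  refine subsingleton_of_forall_eq 0 fun x => ?_
  have := h₁ (n + 1)
  have := h₂ n
  obtain ⟨y, rfl⟩ := Abelian.Ext.covariant_sequence_exact₃ (loc S) hT x rfl (Subsingleton.elim _ _)
  rw [Subsingleton.elim y 0, Abelian.Ext.zero_comp]

instance : (ctra S).IsClosedUnderCokernels where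
  cokernels_le := by
    rintro _ ⟨f, k, hk, hA, hB⟩
    refine (ctra S).prop_of_iso ((cokernelIsCokernel f).coconePointUniqueUpToIso hk) ?_
    have hI : ctra S (Abelian.image f) :=
      ctra_X₃ (kernel_image_shortExact f) (ctra_kernel f hA hB) hA
    have hT : (ShortComplex.mk (Abelian.image.ι f) (cokernel.π f)
        (kernel.condition _)).ShortExact :=
      { exact := ShortComplex.exact_kernel (cokernel.π f) }
    exact ctra_X₃ hT hI hB

end Perp

/-! ### The complexes `M ⟶ S⁻¹M` and `Hom_R(T, M)` -/

/-- The endofunctor `M ↦ S⁻¹M = S⁻¹R ⊗_R M` of the category of `R`-modules. -/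
noncomputable abbrev locFunctor : ModuleCat.{u} R ⥤ ModuleCat.{u} R :=
  ModuleCat.extendScalars.{u, u, u} (algebraMap R (Localization S)) ⋙
    ModuleCat.restrictScalars.{u} (algebraMap R (Localization S))

instance : (ModuleCat.extendScalars.{u, u, u} (algebraMap R (Localization S))).Additive :=
  (ModuleCat.extendRestrictScalarsAdj.{u, u, u} (algebraMap R (Localization S))).left_adjoint_additive

/-- The canonical maps `M ⟶ S⁻¹M`, `x ↦ 1 ⊗ x`. -/
noncomputable abbrev locUnit : 𝟭 (ModuleCat.{u} R) ⟶ locFunctor S :=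
  (ModuleCat.extendRestrictScalarsAdj.{u, u, u} (algebraMap R (Localization S))).unit

/-- The canonical maps `M ⟶ S⁻¹M` for complexes `M` of `R`-modules. -/
noncomputable def locMap :
    𝟭 (CochainComplex (ModuleCat.{u} R) ℤ) ⟶ (locFunctor S).mapHomologicalComplex _ where
  app M :=
    { f i := (locUnit S).app (M.X i)
      comm' i j _ := ((locUnit S).naturality (M.d i j)).symm }
  naturality M N f := by
    ext i : 1
    exact (locUnit S).naturality (f.f i)

/-- The mapping cone of `M ⟶ S⁻¹M`, as a functor of the complex `M`. -/
noncomputable def locCone :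
    CochainComplex (ModuleCat.{u} R) ℤ ⥤ CochainComplex (ModuleCat.{u} R) ℤ where
  obj M := CochainComplex.mappingCone ((locMap S).app M)
  map f := CochainComplex.mappingCone.map _ _ f (((locFunctor S).mapHomologicalComplex _).map f)
    ((locMap S).naturality f).symm
  map_id M := by
    simp only [CategoryTheory.Functor.map_id]
    exact CochainComplex.mappingCone.map_id _
  map_comp {M N K} f g := by
    simp only [CategoryTheory.Functor.map_comp]
    exact CochainComplex.mappingCone.map_comp _ _ _ f _ ((locMap S).naturality f).symm g _
      ((locMap S).naturality g).symm

/-- The functor sending a complex `M` to the total complex of the two-row bicomplex `M ⟶ S⁻¹M`,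
with `M` in row `0` and `S⁻¹M` in row `1`: it is the mapping cocone of `M ⟶ S⁻¹M`, with the term
`M^n ⊕ S⁻¹M^(n-1)` in degree `n`. -/
noncomputable def cech :
    CochainComplex (ModuleCat.{u} R) ℤ ⥤ CochainComplex (ModuleCat.{u} R) ℤ :=
  locCone S ⋙ shiftFunctor _ (-1 : ℤ)

lemma cech_obj (M : CochainComplex (ModuleCat.{u} R) ℤ) :
    (cech S).obj M = CochainComplex.mappingCocone ((locMap S).app M) := rfl

/-- The functor `Hom_R(T, -)` for a complex `T` of `R`-modules: in degree `n`, the complex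
`Hom_R(T, M)` is the `R`-module of families of maps `T^p ⟶ M^q`, `p + n = q`. -/
noncomputable def homFunctor (T : CochainComplex (ModuleCat.{u} R) ℤ) :
    CochainComplex (ModuleCat.{u} R) ℤ ⥤ CochainComplex (ModuleCat.{u} R) ℤ where
  obj M :=
    { X n := ModuleCat.of R (CochainComplex.HomComplex.Cochain T M n)
      d i j := ModuleCat.ofHom (CochainComplex.HomComplex.δ_hom R T M i j)
      shape i j hij := by
        ext x : 2
        exact CochainComplex.HomComplex.δ_shape _ _ hij x
      d_comp_d' i j k _ _ := by
        ext x : 2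
        exact CochainComplex.HomComplex.δ_δ _ _ _ x }
  map {M N} f :=
    { f n := ModuleCat.ofHom
        { toFun z := z.comp (CochainComplex.HomComplex.Cochain.ofHom f) (add_zero n)
          map_add' _ _ := by simp
          map_smul' _ _ := by simp }
      comm' i j _ := by
        ext x : 2
        exact CochainComplex.HomComplex.δ_comp_ofHom x f j }
  map_id M := by
    ext n x : 3
    exact CochainComplex.HomComplex.Cochain.comp_id x
  map_comp f g := by
    ext n x : 3
    simp

/-- A projective resolution `0 ⟶ P₀ ⟶ P₁ ⟶ S⁻¹R ⟶ 0` of the `R`-module `S⁻¹R` together with a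
lifting of the localization map `R ⟶ S⁻¹R` to a map `R ⟶ P₁`. -/
structure LocResolution where
  /-- the term in cohomological degree `0` -/
  P₀ : ModuleCat.{u} R
  /-- the term in cohomological degree `1` -/
  P₁ : ModuleCat.{u} R
  projective₀ : Projective P₀
  projective₁ : Projective P₁
  /-- the differential -/
  d : P₀ ⟶ P₁
  /-- the augmentation -/
  aug : P₁ ⟶ loc S
  d_aug : d ≫ aug = 0
  shortExact : (ShortComplex.mk d aug d_aug).ShortExact
  /-- the lifting of the localization map -/
  lift : ModuleCat.of R R ⟶ P₁
  lift_aug : lift ≫ aug = ModuleCat.ofHom (Algebra.linearMap R (Localization S))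

instance [HasProjectiveDimensionLE (loc S) 1] : Nonempty (LocResolution S) := by
  have hT : (ShortComplex.mk (kernel.ι (Projective.π (loc S))) (Projective.π (loc S))
      (kernel.condition _)).ShortExact :=
    { exact := ShortComplex.exact_kernel _ }
  have hP : Projective (ModuleCat.of R R) :=
    (IsProjective.iff_projective (ModuleCat.of R R)).1 inferInstance
  have h₁ : Projective (kernel (Projective.π (loc S))) :=
    projective_iff_hasProjectiveDimensionLT_one.2
      ((hT.hasProjectiveDimensionLT_X₃_iff 0 (Projective.projective_over (loc S))).1 ‹_›)
  exact ⟨{ P₀ := kernel (Projective.π (loc S))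
           P₁ := Projective.over (loc S)
           d := kernel.ι _
           aug := Projective.π (loc S)
           projective₀ := h₁
           projective₁ := Projective.projective_over (loc S)
           d_aug := kernel.condition _
           shortExact := hT
           lift := Projective.factorThru (ModuleCat.ofHom (Algebra.linearMap R (Localization S)))
             (Projective.π (loc S))
           lift_aug := Projective.factorThru_comp _ _ }⟩

variable {S} in
/-- The two-term complex `T = (R ⊕ P₀ ⟶ P₁)`, in cohomological degrees `0` and `1`. -/
noncomputable def LocResolution.complexT (P : LocResolution S) :
    CochainComplex (ModuleCat.{u} R) ℤ :=
  HomologicalComplex.double (c := ComplexShape.up ℤ) (i₀ := 0) (i₁ := 1)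
    (biprod.desc P.lift P.d) (by simp)

/-! ### Subcategories of `D^⋆(R)` and the Verdier quotient -/

variable [HasDerivedCategory.{w} (ModuleCat.{u} R)]

/-- The objects of `D^⋆(R)` with `S`-torsion cohomology modules. -/
abbrev torsCoh (s : Bdd) : ObjectProperty (DStar.{w} (ModuleCat.{u} R) s) :=
  hasCohomology s (tors S)

/-- The objects of `D^⋆(R)` with `S`-contramodule cohomology modules. -/
abbrev ctraCoh (s : Bdd) : ObjectProperty (DStar.{w} (ModuleCat.{u} R) s) :=
  hasCohomology s (ctra S)

instance (s : Bdd) : (torsCoh.{w} S s).IsTriangulated :=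
  hasCohomology_isTriangulated s (tors S)

instance [HasProjectiveDimensionLE (loc S) 1] (s : Bdd) : (ctraCoh.{w} S s).IsTriangulated :=
  hasCohomology_isTriangulated s (ctra S)

/-- Restriction of scalars `k_* : D^⋆(S⁻¹R) ⥤ D^⋆(R)`. -/
noncomputable abbrev kStar [HasDerivedCategory.{w'} (ModuleCat.{u} (Localization S))] (s : Bdd) :
    DStar.{w'} (ModuleCat.{u} (Localization S)) s ⥤ DStar.{w} (ModuleCat.{u} R) s :=
  mapDStar (ModuleCat.restrictScalars.{u} (algebraMap R (Localization S))) s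

/-- For a full subcategory of `D^⋆(R)`, the category of all complexes of `R`-modules whose image in
the derived category lies in that subcategory. -/
abbrev complexes {s : Bdd} (P : ObjectProperty (DStar.{w} (ModuleCat.{u} R) s)) :
    ObjectProperty (CochainComplex (ModuleCat.{u} R) ℤ) :=
  fun M => ∃ h : s.prop (DerivedCategory.Q.obj M), P ⟨DerivedCategory.Q.obj M, h⟩

/-- The localization functor from complexes to the full subcategory `P` of `D^⋆(R)`. -/
noncomputable abbrev localize {s : Bdd} (P : ObjectProperty (DStar.{w} (ModuleCat.{u} R) s)) :
    (complexes P).FullSubcategory ⥤ P.FullSubcategory :=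
  P.lift (s.prop.lift ((complexes P).ι ⋙ DerivedCategory.Q) fun M => M.property.choose)
    fun M => M.property.choose_spec

section Quotient

variable [HasDerivedCategory.{w'} (ModuleCat.{u} (Localization S))]

/-- The Verdier quotient `D^⋆(R) / D^⋆(S⁻¹R)`: the localization of `D^⋆(R)` at the morphisms whose
cone belongs to the essential image of `k_*`. -/
abbrev Quot (s : Bdd) := (kStar.{w, w'} S s).essImage.trW.Localization

/-- The Verdier quotient functor `D^⋆(R) ⥤ D^⋆(R) / D^⋆(S⁻¹R)`. -/
noncomputable abbrev toQuot (s : Bdd) : DStar.{w} (ModuleCat.{u} R) s ⥤ Quot.{w, w'} S s :=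
  (kStar.{w, w'} S s).essImage.trW.Q

end Quotient

end Modules

end TriangulatedMatlis

open TriangulatedMatlis

namespace TriangulatedMatlis

/-! ### Localization of modules -/

section Localization

variable {R : Type u} [CommRing R] (S : Submonoid R)

/-! Call an `R`-module local if every element of `S` acts on it bijectively. Localization and
restriction of scalars are exact adjoint functors, so they induce an adjunction of derived
categories, computed termwise. Its counit is invertible, hence `k_*` is fully faithful. Its unit at
`X` is invertible exactly when the cohomology of `X` is local, which describes the essential image
and shows it closed under retracts (`mem_essImage_kStar_iff`).

The torsion side is a coreflection modulo this image. Localization kills exactly the complexes with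
torsion cohomology, so these have no nonzero maps to local ones (`eq_zero_of_tors_of_isLocal`). The
cocone of `M ⟶ S⁻¹M` is torsion, and its projection to `M` has a local cone (`tors_homology_cech`,
`trW_cechι`).

The contramodule side is the dual reflection. Let `P` be the resolution `P₀ ⟶ P₁` placed in degrees
`0` and `1`, so `P` is quasi-isomorphic to `S⁻¹R[-1]`. The degreewise split sequence `P ⟶ T ⟶ R`
yields a triangle `M ⟶ Hom(T, M) ⟶ Hom(P, M)`, whose last vertex has local cohomology because `S`
acts invertibly on `P` in the derived category. By projective dimension at most one, a complex `C`
has contramodule cohomology if and only if `Hom(P, C)` is acyclic. Now `Hom(P, Hom(T, M))` is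
acyclic if `Hom(T, Hom(P, M))` is, and the latter is acyclic because `T` has torsion cohomology and
`Hom(P, M)` is local. So `Hom(T, M)` has contramodule cohomology
(`ctra_homology_homFunctor_complexT`). If `C` already has contramodule cohomology, `C ⟶ Hom(T, C)`
is a quasi-isomorphism, and naturality forces every map from a local complex to `C` to vanish
(`eq_zero_of_isLocal_of_ctra`).

Both subcategories are therefore equivalent to the Verdier quotient. The natural maps `M ⟶ Hom(T,
M)` and from the cocone of `A ⟶ S⁻¹A` to `A` become invertible there, and cancelling the fully
faithful functors to the quotient gives the explicit formulas. -/

instance preservesFiniteLimits_extendScalars_localization :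
    PreservesFiniteLimits (ModuleCat.extendScalars.{u, u, u} (algebraMap R (Localization S))) :=
  ModuleCat.preservesFiniteLimits_extendScalars_of_flat
    (RingHom.flat_algebraMap_iff.2 (IsLocalization.flat _ S))

/-- The modules on which every element of `S` acts bijectively. -/
def isLocal : ObjectProperty (ModuleCat.{u} R) :=
  fun M => ∀ s ∈ S, Function.Bijective (fun x : M => s • x)

instance : (isLocal S).IsClosedUnderIsomorphisms where
  of_iso {M N} e h s hs := by
    have := (e.toLinearEquiv.bijective.comp (h s hs)).comp e.toLinearEquiv.symm.bijective
    convert this using 1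
    funext x
    simp

/-- Tensoring with `Localization S` is a localization of modules. The maps `e₁` and `e₂` are
identities on elements; they only reconcile the restricted `R`-actions with the native ones. -/
instance isLocalizedModule_locUnit (M : ModuleCat.{u} R) :
    IsLocalizedModule S ((locUnit S).app M).hom := by
  let e₁ : Localization S ≃ₗ[R] (ModuleCat.restrictScalars.{u} (algebraMap R (Localization S))).obj
      (ModuleCat.of (Localization S) (Localization S)) :=
    { toFun x := x
      invFun x := x
      left_inv _ := rfl
      right_inv _ := rfl
      map_add' _ _ := rfl
      map_smul' r x := Algebra.smul_def r x }
  let e₂ : TensorProduct R ((ModuleCat.restrictScalars.{u} (algebraMap R (Localization S))).obj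
      (ModuleCat.of (Localization S) (Localization S))) M ≃ₗ[R] (locFunctor S).obj M :=
    { toFun x := x
      invFun x := x
      left_inv _ := rfl
      right_inv _ := rfl
      map_add' _ _ := rfl
      map_smul' r x := by
        induction x using TensorProduct.induction_on with
        | zero =>
          exact (smul_zero (A := TensorProduct R _ _) r).trans
            (smul_zero (A := (locFunctor S).obj M) r).symm
        | tmul a m => rfl
        | add a b ha hb =>
          exact (smul_add (A := TensorProduct R _ _) r a b).trans ((congrArg₂ (· + ·) ha hb).trans
            (smul_add (A := (locFunctor S).obj M) r a b).symm) }
  exact inferInstanceAs (IsLocalizedModule S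
    ((TensorProduct.congr e₁ (LinearEquiv.refl R M) ≪≫ₗ e₂).toLinearMap ∘ₗ
      (TensorProduct.mk R (Localization S) M 1)))

lemma isIso_locUnit_app_iff (M : ModuleCat.{u} R) :
    IsIso ((locUnit S).app M) ↔ isLocal S M := by
  rw [ConcreteCategory.isIso_iff_bijective]
  constructor
  · intro h s hs
    let e := LinearEquiv.ofBijective ((locUnit S).app M).hom h
    have h₁ := (Module.End.isUnit_iff _).1
      ((isLocalizedModule_locUnit S M).map_units (⟨s, hs⟩ : S))
    have h₂ : (fun x : M => s • x) = (e.symm ∘ (algebraMap R (Module.End R ((locFunctor S).obj M)) s)) ∘ e := by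
      funext x
      apply e.injective
      simp only [Function.comp_apply, LinearEquiv.apply_symm_apply]
      exact e.map_smul s x
    rw [h₂]
    exact (e.symm.bijective.comp h₁).comp e.bijective
  · intro h
    have hI := isLocalizedModule_locUnit S M
    constructor
    · rw [injective_iff_map_eq_zero]
      intro x hx
      obtain ⟨s, hs⟩ := (IsLocalizedModule.eq_zero_iff S ((locUnit S).app M).hom).1 hx
      exact (h s s.2).1 (hs.trans (smul_zero (s : R)).symm)
    · intro y
      obtain ⟨⟨x, s⟩, hx⟩ := hI.surj y
      obtain ⟨z, rfl⟩ := (h s s.2).2 x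
      refine ⟨z, ((Module.End.isUnit_iff _).1 (hI.map_units s)).1 ?_⟩
      exact (((locUnit S).app M).hom.map_smul (s : R) z).symm.trans hx.symm

lemma isZero_extendScalars_iff (M : ModuleCat.{u} R) :
    IsZero ((ModuleCat.extendScalars.{u, u, u} (algebraMap R (Localization S))).obj M) ↔
      tors S M := by
  rw [ModuleCat.isZero_iff_subsingleton]
  constructor
  · intro h x
    have : ((locUnit S).app M).hom x = 0 := Subsingleton.elim (α := (ModuleCat.extendScalars.{u, u, u}
      (algebraMap R (Localization S))).obj M) _ _
    obtain ⟨s, hs⟩ := (IsLocalizedModule.eq_zero_iff S ((locUnit S).app M).hom).1 this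
    exact ⟨s, s.2, hs⟩
  · intro h
    refine ⟨fun a b => ?_⟩
    have h0 (a : (locFunctor S).obj M) : a = 0 := by
      obtain ⟨⟨x, s⟩, rfl⟩ := IsLocalizedModule.mk'_surjective S ((locUnit S).app M).hom a
      obtain ⟨t, ht, hx⟩ := h x
      simp only [Function.uncurry_apply_pair]
      rw [IsLocalizedModule.mk'_eq_zero, IsLocalizedModule.eq_zero_iff S]
      exact ⟨⟨t, ht⟩, hx⟩
    exact (h0 a).trans (h0 b).symm

/-- By a triangle identity the restricted counit is inverse to the unit at `M`, which is invertible
since `S` acts on `M` by units. Restriction of scalars reflects isomorphisms. -/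
lemma isIso_counit_app (M : ModuleCat.{u} (Localization S)) :
    IsIso ((ModuleCat.extendRestrictScalarsAdj.{u, u, u}
      (algebraMap R (Localization S))).counit.app M) := by
  let F := ModuleCat.restrictScalars.{u} (algebraMap R (Localization S))
  have h : IsIso ((locUnit S).app (F.obj M)) := by
    rw [isIso_locUnit_app_iff]
    intro s hs
    let e := (IsLocalization.map_units (Localization S) (⟨s, hs⟩ : S)).unit
    exact (MulAction.bijective e : Function.Bijective (fun x : M => e • x))
  have h' := (ModuleCat.extendRestrictScalarsAdj.{u, u, u}
    (algebraMap R (Localization S))).right_triangle_components M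
  have : IsIso (F.map ((ModuleCat.extendRestrictScalarsAdj.{u, u, u}
      (algebraMap R (Localization S))).counit.app M)) := by
    rw [← IsIso.eq_inv_comp] at h'
    rw [h']
    infer_instance
  exact isIso_of_reflects_iso _ F

end Localization

/-! ### Adjunctions between exact functors and derived categories -/

section Adjunction

variable {C : Type u} [Category.{v} C] [Abelian C] {D : Type u'} [Category.{v'} D] [Abelian D]
  {F : C ⥤ D} {G : D ⥤ C} [F.Additive] [G.Additive] (adj : F ⊣ G)

/-- An adjunction between additive functors induces an adjunction between categories of
complexes. -/
noncomputable def adjunctionMapHomologicalComplex {ι : Type*} (c : ComplexShape ι) :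
    F.mapHomologicalComplex c ⊣ G.mapHomologicalComplex c :=
  Adjunction.mkOfUnitCounit
    { unit :=
        { app K := { f i := adj.unit.app (K.X i), comm' i j _ := (adj.unit.naturality _).symm } 
          naturality K L f := by ext i : 1; exact adj.unit.naturality _ }
      counit :=
        { app K := { f i := adj.counit.app (K.X i), comm' i j _ := (adj.counit.naturality _).symm } 
          naturality K L f := by ext i : 1; exact adj.counit.naturality _ }
      left_triangle := by
        ext K i : 3
        simp
        exact adj.left_triangle_components (K.X i)
      right_triangle := by
        ext K i : 3
        simp
        exact adj.right_triangle_components (K.X i) }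

variable [HasDerivedCategory.{w} C] [HasDerivedCategory.{w'} D]
  [PreservesFiniteLimits F] [PreservesFiniteColimits F]
  [PreservesFiniteLimits G] [PreservesFiniteColimits G]

noncomputable instance catCommSqMapDerivedCategory (F : C ⥤ D) [F.Additive] [PreservesFiniteLimits F]
    [PreservesFiniteColimits F] :
    CatCommSq (F.mapHomologicalComplex (ComplexShape.up ℤ)) DerivedCategory.Q.{w}
      DerivedCategory.Q.{w'} F.mapDerivedCategory where
  iso := F.mapDerivedCategoryFactors.symm

/-- An adjunction between exact functors induces an adjunction between derived categories. -/
noncomputable def adjunctionMapDerivedCategory :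
    F.mapDerivedCategory (C₁ := C) (C₂ := D) ⊣ G.mapDerivedCategory :=
  (adjunctionMapHomologicalComplex adj (ComplexShape.up ℤ)).localization
    DerivedCategory.Q (HomologicalComplex.quasiIso C (ComplexShape.up ℤ))
    DerivedCategory.Q (HomologicalComplex.quasiIso D (ComplexShape.up ℤ)) _ _

lemma adjunctionMapDerivedCategory_unit_app (K : CochainComplex C ℤ) :
    (adjunctionMapDerivedCategory.{w, w'} adj).unit.app (DerivedCategory.Q.obj K) =
      DerivedCategory.Q.map ((adjunctionMapHomologicalComplex adj _).unit.app K) ≫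
        G.mapDerivedCategoryFactors.inv.app _ ≫
        G.mapDerivedCategory.map (F.mapDerivedCategoryFactors.inv.app K) :=
  Adjunction.localization_unit_app ..

lemma adjunctionMapDerivedCategory_counit_app (K : CochainComplex D ℤ) :
    (adjunctionMapDerivedCategory.{w, w'} adj).counit.app (DerivedCategory.Q.obj K) =
      F.mapDerivedCategory.map (G.mapDerivedCategoryFactors.hom.app K) ≫
        F.mapDerivedCategoryFactors.hom.app _ ≫
        DerivedCategory.Q.map ((adjunctionMapHomologicalComplex adj _).counit.app K) :=
  Adjunction.localization_counit_app ..

/-- On an object represented by a complex, the derived counit is the termwise counit up to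
comparison isomorphisms. -/
lemma isIso_adjunctionMapDerivedCategory_counit (h : ∀ X, IsIso (adj.counit.app X)) :
    IsIso (adjunctionMapDerivedCategory.{w, w'} adj).counit := by
  rw [NatTrans.isIso_iff_isIso_app]
  intro X
  obtain ⟨K, ⟨e⟩⟩ : ∃ K, Nonempty (X ≅ DerivedCategory.Q.obj K) :=
    ⟨_, ⟨(DerivedCategory.Q.objObjPreimageIso X).symm⟩⟩
  rw [NatTrans.isIso_app_iff_of_iso _ e, adjunctionMapDerivedCategory_counit_app]
  have (i : ℤ) : IsIso (((adjunctionMapHomologicalComplex adj _).counit.app K).f i) :=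
    h (K.X i)
  have : IsIso ((adjunctionMapHomologicalComplex adj (ComplexShape.up ℤ)).counit.app K) :=
    HomologicalComplex.Hom.isIso_of_components _
  infer_instance

lemma isIso_adjunctionMapDerivedCategory_unit_app_iff (K : CochainComplex C ℤ) :
    IsIso ((adjunctionMapDerivedCategory.{w, w'} adj).unit.app (DerivedCategory.Q.obj K)) ↔
      QuasiIso ((adjunctionMapHomologicalComplex adj _).unit.app K) := by
  rw [adjunctionMapDerivedCategory_unit_app, isIso_comp_right_iff,
    DerivedCategory.isIso_Q_map_iff_quasiIso]

end Adjunction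

/-! ### Exact functors and homology -/

section Homology

variable {C : Type u} [Category.{v} C] [Abelian C] {D : Type u'} [Category.{v'} D] [Abelian D]

/-- Exact functors commute with homology. -/
noncomputable def mapHomologyIso (F : C ⥤ D) [F.Additive] [PreservesFiniteLimits F]
    [PreservesFiniteColimits F] (K : CochainComplex C ℤ) (n : ℤ) :
    ((F.mapHomologicalComplex _).obj K).homology n ≅ F.obj (K.homology n) :=
  (K.sc n).mapHomologyIso F

lemma isIso_app_homology_iff {F G : C ⥤ D} [F.Additive] [PreservesFiniteLimits F]
    [PreservesFiniteColimits F] [G.Additive] [PreservesFiniteLimits G]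
    [PreservesFiniteColimits G] (τ : F ⟶ G) (K : ShortComplex C) :
    IsIso (τ.app K.homology) ↔ IsIso (ShortComplex.homologyMap (K.mapNatTrans τ)) := by
  rw [NatTrans.app_homology τ K, isIso_comp_left_iff, isIso_comp_right_iff]

/-- Exact functors commute with homology, naturally in the functor, so the map induced by `τ` on
homology is `τ` evaluated at the homology. -/
lemma quasiIso_iff_of_natTrans {F G : C ⥤ D} [F.Additive] [PreservesFiniteLimits F]
    [PreservesFiniteColimits F] [G.Additive] [PreservesFiniteLimits G]
    [PreservesFiniteColimits G] (τ : F ⟶ G) (K : CochainComplex C ℤ) :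
    QuasiIso ((NatTrans.mapHomologicalComplex τ (ComplexShape.up ℤ)).app K) ↔
      ∀ n, IsIso (τ.app (K.homology n)) := by
  rw [quasiIso_iff]
  refine forall_congr' fun n => ?_
  rw [quasiIsoAt_iff_isIso_homologyMap]
  exact (isIso_app_homology_iff τ (K.sc n)).symm

variable [HasDerivedCategory.{w} C]

lemma prop_homologyFunctor_Q_iff (P : ObjectProperty C) [P.IsClosedUnderIsomorphisms]
    (K : CochainComplex C ℤ) (n : ℤ) :
    P ((DerivedCategory.homologyFunctor C n).obj (DerivedCategory.Q.obj K)) ↔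
      P (K.homology n) :=
  P.prop_iff_of_iso ((DerivedCategory.homologyFunctorFactors C n).app K)

lemma isZero_Q_obj_iff (K : CochainComplex C ℤ) :
    IsZero (DerivedCategory.Q.obj K) ↔ ∀ n, IsZero (K.homology n) := by
  constructor
  · intro h n
    exact ((DerivedCategory.homologyFunctor C n).map_isZero h).of_iso
      ((DerivedCategory.homologyFunctorFactors C n).app K).symm
  · intro h
    have : QuasiIso (0 : K ⟶ 0) := by
      rw [quasiIso_iff]
      intro n
      rw [quasiIsoAt_iff_isIso_homologyMap]
      exact (h n).isIso ((HomologicalComplex.homologyFunctor C _ n).map_isZero (isZero_zero _)) _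
    exact (DerivedCategory.Q.map_isZero (isZero_zero _)).of_iso
      (asIso (DerivedCategory.Q.map (0 : K ⟶ 0)))

end Homology

/-! ### Full faithfulness and essential image of `k_*` -/

section Restriction

variable {R : Type u} [CommRing R] (S : Submonoid R)
  [HasDerivedCategory.{w} (ModuleCat.{u} R)]
  [HasDerivedCategory.{w'} (ModuleCat.{u} (Localization S))]

/-- The adjunction between localization and restriction of scalars for derived categories. -/
noncomputable abbrev locAdj := adjunctionMapDerivedCategory.{w, w'}
  (ModuleCat.extendRestrictScalarsAdj.{u, u, u} (algebraMap R (Localization S)))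

instance isIso_locAdj_counit : IsIso (locAdj.{w, w'} S).counit :=
  isIso_adjunctionMapDerivedCategory_counit _ (isIso_counit_app S)

instance full_mapDerivedCategory_restrictScalars :
    ((ModuleCat.restrictScalars.{u} (algebraMap R (Localization S))).mapDerivedCategory :
      DerivedCategory.{w'} _ ⥤ DerivedCategory.{w} _).Full :=
  (locAdj.{w, w'} S).fullyFaithfulROfIsIsoCounit.full

instance faithful_mapDerivedCategory_restrictScalars :
    ((ModuleCat.restrictScalars.{u} (algebraMap R (Localization S))).mapDerivedCategory :
      DerivedCategory.{w'} _ ⥤ DerivedCategory.{w} _).Faithful :=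
  (locAdj.{w, w'} S).fullyFaithfulROfIsIsoCounit.faithful

instance full_kStar (s : Bdd) : (kStar.{w, w'} S s).Full :=
  inferInstance

instance faithful_kStar (s : Bdd) : (kStar.{w, w'} S s).Faithful :=
  inferInstance

variable (X : DerivedCategory.{w} (ModuleCat.{u} R))

omit [HasDerivedCategory.{w} (ModuleCat.{u} R)]
  [HasDerivedCategory.{w'} (ModuleCat.{u} (Localization S))] in
lemma quasiIso_locMap_iff (K : CochainComplex (ModuleCat.{u} R) ℤ) :
    QuasiIso ((locMap S).app K) ↔ ∀ n, isLocal S (K.homology n) := by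
  simp_rw [← isIso_locUnit_app_iff]
  exact quasiIso_iff_of_natTrans (locUnit S) K

lemma isIso_locAdj_unit_app_iff :
    IsIso ((locAdj.{w, w'} S).unit.app X) ↔
      ∀ n, isLocal S ((DerivedCategory.homologyFunctor _ n).obj X) := by
  obtain ⟨K, ⟨e⟩⟩ : ∃ K, Nonempty (X ≅ DerivedCategory.Q.obj K) :=
    ⟨_, ⟨(DerivedCategory.Q.objObjPreimageIso X).symm⟩⟩
  have h (n : ℤ) := (isLocal S).prop_iff_of_iso
    ((DerivedCategory.homologyFunctor _ n).mapIso e)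
  simp_rw [h, prop_homologyFunctor_Q_iff, ← quasiIso_locMap_iff]
  rw [NatTrans.isIso_app_iff_of_iso _ e, isIso_adjunctionMapDerivedCategory_unit_app_iff]
  rfl

lemma isZero_extendScalars_obj_iff :
    IsZero (((ModuleCat.extendScalars.{u, u, u} (algebraMap R (Localization S))).mapDerivedCategory :
      _ ⥤ DerivedCategory.{w'} _).obj X) ↔
      ∀ n, tors S ((DerivedCategory.homologyFunctor _ n).obj X) := by
  obtain ⟨K, ⟨e⟩⟩ : ∃ K, Nonempty (X ≅ DerivedCategory.Q.obj K) :=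
    ⟨_, ⟨(DerivedCategory.Q.objObjPreimageIso X).symm⟩⟩
  have h (n : ℤ) := (tors S).prop_iff_of_iso
    ((DerivedCategory.homologyFunctor _ n).mapIso e)
  simp_rw [h, prop_homologyFunctor_Q_iff, ← isZero_extendScalars_iff]
  rw [Iso.isZero_iff ((ModuleCat.extendScalars.{u, u, u}
    (algebraMap R (Localization S))).mapDerivedCategory.mapIso e ≪≫
    (ModuleCat.extendScalars.{u, u, u}
    (algebraMap R (Localization S))).mapDerivedCategoryFactors.app K)]
  refine (isZero_Q_obj_iff _).trans (forall_congr' fun n => ?_)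
  exact (mapHomologyIso (ModuleCat.extendScalars.{u, u, u}
    (algebraMap R (Localization S))) K n).isZero_iff

/-- With a fully faithful right adjoint, the image consists of the objects at which the unit is
invertible. The bound `s` adds no condition, since exact localization preserves each `D^⋆` and so
the preimage found in the unbounded category already lies in it. -/
lemma mem_essImage_kStar_iff (s : Bdd) (X : DStar.{w} (ModuleCat.{u} R) s) :
    (kStar.{w, w'} S s).essImage X ↔
      ∀ n, isLocal S ((DerivedCategory.homologyFunctor _ n).obj X.obj) := by
  rw [← isIso_locAdj_unit_app_iff.{w, w'}]
  constructor
  · rintro ⟨Y, ⟨e⟩⟩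
    exact (locAdj.{w, w'} S).isIso_unit_app_of_iso ((s.prop.ι.mapIso e).symm)
  · intro h
    exact ⟨⟨_, prop_mapDerivedCategory.{w, w'} (ModuleCat.extendScalars.{u, u, u}
      (algebraMap R (Localization S))) s X⟩,
      ⟨s.prop.isoMk (asIso ((locAdj.{w, w'} S).unit.app X.obj)).symm⟩⟩

/-- A retract of objects makes the unit at one a retract, as an arrow, of the unit at the other, and
isomorphisms are stable under retracts. -/
instance isStableUnderRetracts_essImage_kStar (s : Bdd) :
    (kStar.{w, w'} S s).essImage.IsStableUnderRetracts where
  of_retract {X Y} r h := by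
    rw [mem_essImage_kStar_iff, ← isIso_locAdj_unit_app_iff.{w, w'}] at h ⊢
    refine (MorphismProperty.isomorphisms _).of_retract
      (f := (locAdj.{w, w'} S).unit.app X.obj) (g := (locAdj.{w, w'} S).unit.app Y.obj) ?_ h
    let r' := r.map s.prop.ι
    let F := (ModuleCat.extendScalars.{u, u, u} (algebraMap R (Localization S))).mapDerivedCategory ⋙
      (ModuleCat.restrictScalars.{u} (algebraMap R (Localization S))).mapDerivedCategory
    exact
      { i := Arrow.homMk r'.i (F.map r'.i) ((locAdj.{w, w'} S).unit.naturality r'.i)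
        r := Arrow.homMk r'.r (F.map r'.r) ((locAdj.{w, w'} S).unit.naturality r'.r)
        retract := by
          ext
          · exact r'.retract
          · exact (r'.map F).retract }

omit [HasDerivedCategory.{w'} (ModuleCat.{u} (Localization S))] in
lemma eq_zero_of_tors_of_isLocal {X Y : DerivedCategory.{w} (ModuleCat.{u} R)}
    (hX : ∀ n, tors S ((DerivedCategory.homologyFunctor _ n).obj X))
    (hY : ∀ n, isLocal S ((DerivedCategory.homologyFunctor _ n).obj Y)) (f : X ⟶ Y) : f = 0 := by
  -- The derived category over `S⁻¹R` is auxiliary here: followed by the unit at `Y`, the map `f`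
  -- factors through the localization of `X`, which is zero.
  let := HasDerivedCategory.standard (ModuleCat.{u} (Localization S))
  rw [← isIso_locAdj_unit_app_iff] at hY
  rw [← isZero_extendScalars_obj_iff] at hX
  rw [← cancel_mono ((locAdj S).unit.app Y), zero_comp, ← (locAdj S).unit_naturality f,
    hX.eq_of_src ((ModuleCat.extendScalars.{u, u, u}
      (algebraMap R (Localization S))).mapDerivedCategory.map f) 0]
  simp

end Restriction

/-! ### Verdier quotients and orthogonal subcategories -/

section Orthogonal

variable {T : Type u} [Category.{v} T] [Preadditive T] [HasZeroObject T] [HasShift T ℤ]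
  [∀ n : ℤ, (shiftFunctor T n).Additive] [Pretriangulated T] [IsTriangulated T]
  (A B : ObjectProperty T) [B.IsTriangulated]

/-- Morphisms out of an object left orthogonal to `B` are unchanged in the Verdier quotient, which
gives full faithfulness; the approximations in `h` give essential surjectivity. -/
lemma isEquivalence_of_le_leftOrthogonal (hA : A ≤ B.leftOrthogonal)
    (h : ∀ X, ∃ (Y : T) (_ : A Y) (f : Y ⟶ X), B.trW f) :
    (A.ι ⋙ B.trW.Q).IsEquivalence where
  faithful := ⟨fun {X Y f g} hfg => A.ι.map_injective
    (((hA _ X.property).map_bijective_of_isTriangulated B.trW.Q Y.obj).1 hfg)⟩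
  full := ⟨fun {X Y} f => by
    obtain ⟨g, hg⟩ := ((hA _ X.property).map_bijective_of_isTriangulated B.trW.Q Y.obj).2 f
    exact ⟨ObjectProperty.homMk g, hg⟩⟩
  essSurj := ⟨fun Z => by
    obtain ⟨Y, hY, f, hf⟩ := h (B.trW.Q.objPreimage Z)
    exact ⟨⟨Y, hY⟩, ⟨Localization.isoOfHom B.trW.Q B.trW f hf ≪≫
      B.trW.Q.objObjPreimageIso Z⟩⟩⟩

lemma isEquivalence_of_le_rightOrthogonal (hA : A ≤ B.rightOrthogonal)
    (h : ∀ X, ∃ (Y : T) (_ : A Y) (f : X ⟶ Y), B.trW f) :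
    (A.ι ⋙ B.trW.Q).IsEquivalence where
  faithful := ⟨fun {X Y f g} hfg => A.ι.map_injective
    (((hA _ Y.property).map_bijective_of_isTriangulated B.trW.Q X.obj).1 hfg)⟩
  full := ⟨fun {X Y} f => by
    obtain ⟨g, hg⟩ := ((hA _ Y.property).map_bijective_of_isTriangulated B.trW.Q X.obj).2 f
    exact ⟨ObjectProperty.homMk g, hg⟩⟩
  essSurj := ⟨fun Z => by
    obtain ⟨Y, hY, f, hf⟩ := h (B.trW.Q.objPreimage Z)
    exact ⟨⟨Y, hY⟩, ⟨(Localization.isoOfHom B.trW.Q B.trW f hf).symm ≪≫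
      B.trW.Q.objObjPreimageIso Z⟩⟩⟩

end Orthogonal

/-! ### Composing triangulated equivalences over a common target -/

section Equivalences

variable {𝒜 ℬ 𝒬 : Type*} [Category* 𝒜] [Category* ℬ] [Category* 𝒬]
  [HasShift 𝒜 ℤ] [HasShift ℬ ℤ] [HasShift 𝒬 ℤ]
  [Preadditive 𝒜] [Preadditive ℬ] [Preadditive 𝒬]
  [HasZeroObject 𝒜] [HasZeroObject ℬ] [HasZeroObject 𝒬]
  [∀ n : ℤ, (shiftFunctor 𝒜 n).Additive] [∀ n : ℤ, (shiftFunctor ℬ n).Additive]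
  [∀ n : ℤ, (shiftFunctor 𝒬 n).Additive] [Pretriangulated 𝒜] [Pretriangulated ℬ]
  [Pretriangulated 𝒬]

/-- Go to `𝒬` along `EF` and return along the inverse of `EG`, which is again triangulated. The
comparison over `𝒬` is the counit of `EG`, so its compatibility with shifts follows from that of the
counit. -/
lemma exists_triangulated_equivalence_of_equivalences (EF : 𝒜 ≌ 𝒬) (EG : ℬ ≌ 𝒬)
    [EF.functor.CommShift ℤ] [EG.functor.CommShift ℤ] [EF.functor.IsTriangulated]
    [EG.functor.IsTriangulated] :
    ∃ (E : 𝒜 ≌ ℬ) (_ : E.functor.CommShift ℤ) (_ : E.inverse.CommShift ℤ) (_ : E.CommShift ℤ),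
      E.IsTriangulated ∧
        ∃ e : E.functor ⋙ EG.functor ≅ EF.functor, NatTrans.CommShift e.hom ℤ := by
  let := EF.commShiftInverse ℤ
  let := EG.commShiftInverse ℤ
  have := EF.commShift_of_functor ℤ
  have := EG.commShift_of_functor ℤ
  have : EF.IsTriangulated := Equivalence.IsTriangulated.mk' _ inferInstance
  have : EG.IsTriangulated := Equivalence.IsTriangulated.mk' _ inferInstance
  have : EG.symm.IsTriangulated := inferInstance
  refine ⟨EF.trans EG.symm, inferInstance, inferInstance, inferInstance, inferInstance,
    Functor.associator _ _ _ ≪≫ Functor.isoWhiskerLeft EF.functor EG.counitIso ≪≫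
      EF.functor.rightUnitor, ?_⟩
  have h₁ : NatTrans.CommShift EG.counitIso.hom ℤ := inferInstance
  have h₂ : NatTrans.CommShift (Functor.whiskerLeft EF.functor EG.counitIso.hom) ℤ := inferInstance
  have h₃ : NatTrans.CommShift (Functor.associator EF.functor EG.inverse EG.functor).hom ℤ :=
    inferInstance
  have h₄ : NatTrans.CommShift EF.functor.rightUnitor.hom ℤ := inferInstance
  have h₅ : NatTrans.CommShift (Functor.whiskerLeft EF.functor EG.counitIso.hom ≫
      EF.functor.rightUnitor.hom) ℤ := NatTrans.CommShift.comp _ _ _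
  exact NatTrans.CommShift.comp (Functor.associator EF.functor EG.inverse EG.functor).hom
    (Functor.whiskerLeft EF.functor EG.counitIso.hom ≫ EF.functor.rightUnitor.hom) ℤ

lemma exists_triangulated_equivalence (F : 𝒜 ⥤ 𝒬) (G : ℬ ⥤ 𝒬) [F.IsEquivalence]
    [G.IsEquivalence] [hF : F.CommShift ℤ] [hG : G.CommShift ℤ] [hF' : F.IsTriangulated]
    [hG' : G.IsTriangulated] :
    ∃ (E : 𝒜 ≌ ℬ) (_ : E.functor.CommShift ℤ) (_ : E.inverse.CommShift ℤ) (_ : E.CommShift ℤ),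
      E.IsTriangulated ∧ ∃ e : E.functor ⋙ G ≅ F, NatTrans.CommShift e.hom ℤ :=
  -- The structures on `F` and `G` are passed explicitly, the functors of the two equivalences being
  -- `F` and `G` by unfolding.
  @exists_triangulated_equivalence_of_equivalences _ _ _ _ _ _ _ _ _ _ _ _ _ _ _ _ _ _ _ _ _
    F.asEquivalence G.asEquivalence hF hG hF' hG'

end Equivalences

/-! ### The localization triangle -/

section MappingCocone

open CochainComplex

variable {C : Type u} [Category.{v} C] [Abelian C] {K₁ L₁ K₂ L₂ : CochainComplex C ℤ}

/-- The sign in the definition of the projection cancels the one coming from the left shift by one.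
-/
lemma mappingCocone_fst_f (φ : K₁ ⟶ L₁) (n : ℤ) :
    (mappingCocone.fst φ).f n = (mappingCone.fst φ).1.v (n + -1) n (by lia) := by
  have h {X Y : C} (f : X ⟶ Y) : -(-(𝟙 X ≫ f)) = f := by simp
  simp only [mappingCocone.fst, HomologicalComplex.neg_f_apply, HomComplex.Cocycle.homOf_f,
    HomComplex.Cocycle.leftShift_coe,
    HomComplex.Cochain.leftShift_v (n := 1) _ _ _ _ n n _ (n + -1) (by lia)]
  simp
  exact h _

lemma mappingCocone_fst_naturality (φ₁ : K₁ ⟶ L₁) (φ₂ : K₂ ⟶ L₂) (a : K₁ ⟶ K₂) (b : L₁ ⟶ L₂)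
    (comm : φ₁ ≫ b = a ≫ φ₂) :
    (mappingCone.map φ₁ φ₂ a b comm)⟦(-1 : ℤ)⟧' ≫ mappingCocone.fst φ₂ =
      mappingCocone.fst φ₁ ≫ a := by
  ext n : 1
  have h : (mappingCone.map φ₁ φ₂ a b comm).f (n + -1) ≫
      (mappingCone.fst φ₂).1.v (n + -1) n (by lia) =
      (mappingCone.fst φ₁).1.v (n + -1) n (by lia) ≫ a.f n := by
    rw [mappingCone.ext_from_iff _ n (n + -1) (by lia)]
    constructor <;> simp [mappingCone.map]
  change (mappingCone.map φ₁ φ₂ a b comm).f (n + -1) ≫ (mappingCocone.fst φ₂).f n =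
    (mappingCocone.fst φ₁).f n ≫ a.f n
  rw [mappingCocone_fst_f, mappingCocone_fst_f]
  exact h

end MappingCocone

section Cech

variable {R : Type u} [CommRing R] (S : Submonoid R)

/-- The projection of the complex `M ⟶ S⁻¹M` to `M`. -/
noncomputable def cechι : cech S ⟶ 𝟭 (CochainComplex (ModuleCat.{u} R) ℤ) where
  app M := CochainComplex.mappingCocone.fst ((locMap S).app M)
  naturality _ _ f := mappingCocone_fst_naturality _ _ f _ ((locMap S).naturality f).symm

end Cech

/-! ### Torsion cohomology of the cocone, and morphisms with local cone -/

section Torsion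

variable {R : Type u} [CommRing R] (S : Submonoid R)

lemma isLocal_homology_locFunctor (M : CochainComplex (ModuleCat.{u} R) ℤ) (n : ℤ) :
    isLocal S ((((locFunctor S).mapHomologicalComplex _).obj M).homology n) := by
  have h : isLocal S ((locFunctor S).obj (M.homology n)) := fun s hs =>
    (Module.End.isUnit_iff _).1 ((isLocalizedModule_locUnit S _).map_units (⟨s, hs⟩ : S))
  exact (isLocal S).prop_of_iso (mapHomologyIso (locFunctor S) M n).symm h

variable [HasDerivedCategory.{w} (ModuleCat.{u} R)]

/-- Localization sends the unit to an isomorphism, by a triangle identity and invertibility of the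
counit. It therefore sends `M ⟶ S⁻¹M` to an isomorphism and the cocone to zero. -/
lemma tors_homology_cech (M : CochainComplex (ModuleCat.{u} R) ℤ) (n : ℤ) :
    tors S ((DerivedCategory.homologyFunctor _ n).obj (DerivedCategory.Q.obj ((cech S).obj M))) := by
  revert n
  let := HasDerivedCategory.standard (ModuleCat.{u} (Localization S))
  rw [← isZero_extendScalars_obj_iff]
  let E : DerivedCategory (ModuleCat.{u} R) ⥤ DerivedCategory (ModuleCat.{u} (Localization S)) :=
    (ModuleCat.extendScalars.{u, u, u} (algebraMap R (Localization S))).mapDerivedCategory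
  have h₁ : IsIso (E.map ((locAdj S).unit.app (DerivedCategory.Q.obj M))) := by
    have := (locAdj S).left_triangle_components (DerivedCategory.Q.obj M)
    refine (isIso_comp_right_iff _ ((locAdj S).counit.app (E.obj (DerivedCategory.Q.obj M)))).1 ?_
    rw [this]
    exact inferInstanceAs (IsIso (𝟙 (E.obj (DerivedCategory.Q.obj M))))
  have h₂ : IsIso (E.map (DerivedCategory.Q.map ((locMap S).app M))) := by
    rw [adjunctionMapDerivedCategory_unit_app, Functor.map_comp, isIso_comp_right_iff] at h₁
    exact h₁
  exact (Triangle.isZero₁_iff_isIso₂ _ (E.map_distinguished _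
    (DerivedCategory.mappingCocone_triangle_distinguished ((locMap S).app M)))).2 h₂

variable [HasDerivedCategory.{w'} (ModuleCat.{u} (Localization S))]

/-- Cones are unique up to isomorphism, so the cone condition in `D^⋆` can be tested on any triangle
in the unbounded derived category. -/
lemma trW_essImage_kStar_of_distTriang {s : Bdd} {X Y : DStar.{w} (ModuleCat.{u} R) s} (f : X ⟶ Y)
    {T : Triangle (DerivedCategory.{w} (ModuleCat.{u} R))} (hT : T ∈ distTriang _)
    (e : Arrow.mk f.hom ≅ Arrow.mk T.mor₁)
    (h : ∀ n, isLocal S ((DerivedCategory.homologyFunctor _ n).obj T.obj₃)) :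
    (kStar.{w, w'} S s).essImage.trW f := by
  obtain ⟨Z, g, k, hZ⟩ := distinguished_cocone_triangle f
  refine ⟨Z, g, k, hZ, ?_⟩
  rw [mem_essImage_kStar_iff]
  intro n
  have e' : Z.obj ≅ T.obj₃ := Triangle.π₃.mapIso (isoTriangleOfIso₁₂ _ _ (s.prop.ι.map_distinguished _ hZ) hT
    (Arrow.leftFunc.mapIso e) (Arrow.rightFunc.mapIso e) e.hom.w.symm)
  exact (isLocal S).prop_of_iso ((DerivedCategory.homologyFunctor _ n).mapIso e'.symm) (h n)

end Torsion

/-! ### Homology modules in terms of elements -/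

section Elements

variable {R : Type u} [CommRing R] (N : CochainComplex (ModuleCat.{u} R) ℤ) (n : ℤ)

lemma exists_homologyπ_eq (y : N.homology n) : ∃ x : N.cycles n, N.homologyπ n x = y :=
  (ModuleCat.epi_iff_surjective _).1 inferInstance y

variable {N n} in
lemma exists_iCycles_eq (x : N.X n) (hx : N.d n (n + 1) x = 0) :
    ∃ c : N.cycles n, N.iCycles n c = x :=
  (ShortComplex.moduleCat_exact_iff _).1
    (ShortComplex.exact_of_f_is_kernel (ShortComplex.mk _ _ (N.iCycles_d n (n + 1)))
      (N.cyclesIsKernel n (n + 1) (by simp))) x hx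

lemma d_iCycles (c : N.cycles n) : N.d n (n + 1) (N.iCycles n c) = 0 :=
  ConcreteCategory.congr_hom (N.iCycles_d n (n + 1)) c

lemma homologyπ_eq_zero_iff (c : N.cycles n) :
    N.homologyπ n c = 0 ↔ ∃ y : N.X (n - 1), N.d (n - 1) n y = N.iCycles n c := by
  have hw : N.toCycles (n - 1) n ≫ N.homologyπ n = 0 := N.toCycles_comp_homologyπ _ _
  have h := (ShortComplex.moduleCat_exact_iff _).1
    (ShortComplex.exact_of_g_is_cokernel (ShortComplex.mk _ _ hw)
      (N.homologyIsCokernel (n - 1) n (by simp))) c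
  constructor
  · intro hc
    obtain ⟨y, hy⟩ := h hc
    refine ⟨y, ?_⟩
    rw [← hy]
    exact (ConcreteCategory.congr_hom (N.toCycles_i (n - 1) n) y).symm
  · rintro ⟨y, hy⟩
    have : c = N.toCycles (n - 1) n y := by
      refine (ModuleCat.mono_iff_injective (N.iCycles n)).1 inferInstance ?_
      rw [← hy]
      exact (ConcreteCategory.congr_hom (N.toCycles_i (n - 1) n) y).symm
    rw [this]
    exact ConcreteCategory.congr_hom hw y

lemma isZero_homology_iff :
    IsZero (N.homology n) ↔
      ∀ x : N.X n, N.d n (n + 1) x = 0 → ∃ y : N.X (n - 1), N.d (n - 1) n y = x := by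
  rw [ModuleCat.isZero_iff_subsingleton]
  constructor
  · intro h x hx
    obtain ⟨c, rfl⟩ := exists_iCycles_eq x hx
    exact (homologyπ_eq_zero_iff N n c).1 (Subsingleton.elim _ _)
  · refine fun h => subsingleton_of_forall_eq 0 fun y => ?_
    obtain ⟨c, rfl⟩ := exists_homologyπ_eq N n y
    exact (homologyπ_eq_zero_iff N n c).2 (h _ (d_iCycles N n c))

variable (S : Submonoid R)

lemma tors_homology_iff :
    tors S (N.homology n) ↔
      ∀ x : N.X n, N.d n (n + 1) x = 0 → ∃ s ∈ S, ∃ y : N.X (n - 1), N.d (n - 1) n y = s • x := by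
  constructor
  · intro h x hx
    obtain ⟨c, rfl⟩ := exists_iCycles_eq x hx
    obtain ⟨s, hs, e⟩ := h (N.homologyπ n c)
    rw [← map_smul, homologyπ_eq_zero_iff, map_smul] at e
    exact ⟨s, hs, e⟩
  · intro h y
    obtain ⟨c, rfl⟩ := exists_homologyπ_eq N n y
    obtain ⟨s, hs, e⟩ := h _ (d_iCycles N n c)
    refine ⟨s, hs, ?_⟩
    rwa [← map_smul, homologyπ_eq_zero_iff, map_smul]

/-- The hypotheses are injectivity and surjectivity of each `s` on cohomology, in terms of cocycles,
which suits complexes of homomorphisms. -/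
lemma isLocal_homology
    (h₁ : ∀ s ∈ S, ∀ x : N.X n, N.d n (n + 1) x = 0 →
      (∃ y : N.X (n - 1), N.d (n - 1) n y = s • x) → ∃ y : N.X (n - 1), N.d (n - 1) n y = x)
    (h₂ : ∀ s ∈ S, ∀ x : N.X n, N.d n (n + 1) x = 0 →
      ∃ x' : N.X n, N.d n (n + 1) x' = 0 ∧ ∃ y : N.X (n - 1), N.d (n - 1) n y = s • x' - x) :
    isLocal S (N.homology n) := by
  refine fun s hs => ⟨(injective_iff_map_eq_zero (Module.toModuleEnd R _ s)).2 fun y hy => ?_,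
    fun y => ?_⟩
  · obtain ⟨c, rfl⟩ := exists_homologyπ_eq N n y
    have hy' : s • N.homologyπ n c = 0 := hy
    rw [← map_smul, homologyπ_eq_zero_iff, map_smul] at hy'
    exact (homologyπ_eq_zero_iff N n c).2 (h₁ s hs _ (d_iCycles N n c) hy')
  · obtain ⟨c, rfl⟩ := exists_homologyπ_eq N n y
    obtain ⟨x', hx', y, hy⟩ := h₂ s hs _ (d_iCycles N n c)
    obtain ⟨c', rfl⟩ := exists_iCycles_eq x' hx'
    refine ⟨N.homologyπ n c', ?_⟩
    change s • N.homologyπ n c' = _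
    rw [← sub_eq_zero, ← map_smul, ← map_sub, homologyπ_eq_zero_iff]
    exact ⟨y, by rw [hy, map_sub, map_smul]⟩

end Elements

/-! ### Cohomology of complexes of homomorphisms -/

section HomFunctor

open CochainComplex HomComplex

variable {R : Type u} [CommRing R] (X M : CochainComplex (ModuleCat.{u} R) ℤ)
  [HasDerivedCategory.{w} (ModuleCat.{u} R)]

lemma Q_map_bijective_of_isKProjective [X.IsKProjective] :
    Function.Bijective (fun f : (HomotopyCategory.quotient _ _).obj X ⟶
      (HomotopyCategory.quotient _ _).obj M => DerivedCategory.Qh.map f) :=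
  IsKProjective.Qh_map_bijective _ _

variable {X M}

lemma exists_Q_map_eq [X.IsKProjective] (f : DerivedCategory.Q.obj X ⟶ DerivedCategory.Q.obj M) :
    ∃ g : X ⟶ M, DerivedCategory.Q.map g = f := by
  obtain ⟨g, hg⟩ := (Q_map_bijective_of_isKProjective X M).2 f
  obtain ⟨g, rfl⟩ := (HomotopyCategory.quotient _ _).map_surjective g
  exact ⟨g, hg⟩

lemma Q_map_eq_zero_iff [X.IsKProjective] (g : X ⟶ M) :
    DerivedCategory.Q.map g = 0 ↔ (HomotopyCategory.quotient _ _).map g = 0 := by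
  rw [← (Q_map_bijective_of_isKProjective X M).1.eq_iff]
  rw [DerivedCategory.Qh.map_zero]
  rfl

omit [HasDerivedCategory.{w} (ModuleCat.{u} R)] in
lemma mem_coboundaries_iff_exists {n : ℤ} (z : Cocycle X M n) :
    z ∈ coboundaries X M n ↔ ∃ y : Cochain X M (n - 1), δ (n - 1) n y = z.1 :=
  mem_coboundaries_iff _ (n - 1) (by lia)

/-- Degree `n` cohomology of `Hom(X, M)` consists of homotopy classes of maps `X ⟶ M⟦n⟧`; for
K-projective `X` these are the morphisms in the derived category. -/
lemma mem_coboundaries_iff_Q_map_eq_zero [X.IsKProjective] {n : ℤ} (z : Cocycle X M n) :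
    z ∈ coboundaries X M n ↔ DerivedCategory.Q.map (Cocycle.equivHomShift.symm z) = 0 := by
  rw [← CohomologyClass.mk_eq_zero_iff, ← (CohomologyClass.toHom_bijective _ _ _).1.eq_iff,
    map_zero, CohomologyClass.toHom_mk, Q_map_eq_zero_iff]

variable (X M)

lemma isZero_homology_homFunctor_iff [X.IsKProjective] (n : ℤ) :
    IsZero (((homFunctor X).obj M).homology n) ↔
      ∀ f : DerivedCategory.Q.obj X ⟶ DerivedCategory.Q.obj (M⟦n⟧), f = 0 := by
  rw [isZero_homology_iff]
  constructor
  · intro h f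
    obtain ⟨g, rfl⟩ := exists_Q_map_eq f
    obtain ⟨z, rfl⟩ := Cocycle.equivHomShift.symm.surjective g
    rw [← mem_coboundaries_iff_Q_map_eq_zero, mem_coboundaries_iff_exists]
    exact h z.1 (z.δ_eq_zero (n + 1))
  · intro h x hx
    have := (mem_coboundaries_iff_Q_map_eq_zero (Cocycle.mk x (n + 1) rfl hx)).2 (h _)
    rwa [mem_coboundaries_iff_exists] at this

lemma isLocal_homology_homFunctor [X.IsKProjective] (S : Submonoid R)
    (h : ∀ s ∈ S, IsIso (s • 𝟙 (DerivedCategory.Q.obj X))) (n : ℤ) :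
    isLocal S (((homFunctor X).obj M).homology n) := by
  -- Scaling a cocycle by `s` is precomposition with `s` on `X`, which is invertible in the derived
  -- category by `h`.
  have hsmul (s : R) (z : Cocycle X M n) :
      DerivedCategory.Q.map (Cocycle.equivHomShift.symm (s • z)) =
        (s • 𝟙 (DerivedCategory.Q.obj X)) ≫ DerivedCategory.Q.map (Cocycle.equivHomShift.symm z) := by
    have : s • z = z.precomp (s • 𝟙 X) := by
      ext p q hpq
      simp
    rw [this, Cocycle.equivHomShift_symm_precomp, Functor.map_comp, Functor.map_smul,
      CategoryTheory.Functor.map_id]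
  apply isLocal_homology
  · intro s hs x hx hy
    let z := Cocycle.mk x (n + 1) rfl hx
    have := h s hs
    have h₁ := (mem_coboundaries_iff_Q_map_eq_zero (s • z)).1 ((mem_coboundaries_iff_exists _).2 hy)
    rw [hsmul] at h₁
    exact (mem_coboundaries_iff_exists z).1 ((mem_coboundaries_iff_Q_map_eq_zero z).2
      ((cancel_epi (s • 𝟙 (DerivedCategory.Q.obj X))).1 (h₁.trans comp_zero.symm)))
  · intro s hs x hx
    let z := Cocycle.mk x (n + 1) rfl hx
    have := h s hs
    -- Division by `s` takes place in the derived category; K-projectivity brings the quotient back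
    -- to a cocycle.
    obtain ⟨g, hg⟩ := exists_Q_map_eq (inv (s • 𝟙 (DerivedCategory.Q.obj X)) ≫
      DerivedCategory.Q.map (Cocycle.equivHomShift.symm z))
    obtain ⟨z', rfl⟩ := Cocycle.equivHomShift.symm.surjective g
    refine ⟨z'.1, z'.δ_eq_zero (n + 1), ?_⟩
    refine (mem_coboundaries_iff_exists (s • z' - z)).1 ((mem_coboundaries_iff_Q_map_eq_zero _).2 ?_)
    rw [map_sub, Functor.map_sub, hsmul, hg, IsIso.hom_inv_id_assoc, sub_self]

end HomFunctor

/-! ### Functoriality of complexes of homomorphisms in the first variable -/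

section Precomp

open CochainComplex HomComplex

variable {R : Type u} [CommRing R] {X Y : CochainComplex (ModuleCat.{u} R) ℤ}

/-- The map `Hom_R(Y, M) ⟶ Hom_R(X, M)` induced by a map `X ⟶ Y` of complexes. -/
noncomputable def homPrecomp (f : X ⟶ Y) : homFunctor Y ⟶ homFunctor X where
  app M :=
    { f n := ModuleCat.ofHom
        { toFun z := (Cochain.ofHom f).comp z (zero_add n)
          map_add' _ _ := Cochain.comp_add _ _ _ _
          map_smul' _ _ := Cochain.comp_smul _ _ _ _ }
      comm' i j _ := by
        ext x : 2
        exact δ_ofHom_comp f x j }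
  naturality M N g := by
    ext n x : 3
    exact (Cochain.comp_assoc_of_first_is_zero_cochain (Cochain.ofHom f) x (Cochain.ofHom g)
      (add_zero n)).symm

variable {Z : CochainComplex (ModuleCat.{u} R) ℤ} (f : X ⟶ Y) (g : Y ⟶ Z) (w : f ≫ g = 0)
  (M : CochainComplex (ModuleCat.{u} R) ℤ)

include w in
lemma homPrecomp_comp_app : (homPrecomp g).app M ≫ (homPrecomp f).app M = 0 := by
  refine HomologicalComplex.hom_ext _ _ fun n => ModuleCat.hom_ext (LinearMap.ext ?_)
  intro (z : Cochain Z M n)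
  change (Cochain.ofHom f).comp ((Cochain.ofHom g).comp z (zero_add n)) (zero_add n) = 0
  ext p q hpq : 1
  rw [Cochain.zero_cochain_comp_v, Cochain.zero_cochain_comp_v, Cochain.ofHom_v, Cochain.ofHom_v,
    Cochain.zero_v, ← Category.assoc, ← HomologicalComplex.comp_f, w,
    HomologicalComplex.zero_f_apply, zero_comp]

/-- The splittings need not commute with differentials: exactness is checked degree by degree, and
precomposition with `s` and `r` supplies the preimages. -/
lemma homPrecomp_shortExact (s : ∀ n, Z.X n ⟶ Y.X n) (r : ∀ n, Y.X n ⟶ X.X n)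
    (hr : ∀ n, f.f n ≫ r n = 𝟙 _) (hs : ∀ n, s n ≫ g.f n = 𝟙 _)
    (hid : ∀ n, r n ≫ f.f n + g.f n ≫ s n = 𝟙 _) :
    (ShortComplex.mk _ _ (homPrecomp_comp_app f g w M)).ShortExact := by
  refine HomologicalComplex.shortExact_of_degreewise_shortExact _ fun n => ?_
  refine ShortComplex.ShortExact.mk' ?_ ?_ ?_
  · rw [ShortComplex.moduleCat_exact_iff]
    intro (z : Cochain Y M n) (hz : (Cochain.ofHom f).comp z (zero_add n) = 0)
    refine ⟨(Cochain.ofHoms s).comp z (zero_add n), ?_⟩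
    change (Cochain.ofHom g).comp ((Cochain.ofHoms s).comp z (zero_add n))
      (zero_add n) = z
    ext p q hpq : 1
    have hz' := Cochain.congr_v hz p q hpq
    rw [Cochain.zero_cochain_comp_v, Cochain.ofHom_v, Cochain.zero_v] at hz'
    conv_rhs => rw [← Category.id_comp (z.v p q hpq), ← hid]
    rw [Cochain.zero_cochain_comp_v, Cochain.zero_cochain_comp_v, Cochain.ofHom_v,
      Cochain.ofHoms_v, Preadditive.add_comp, Category.assoc, hz', comp_zero, zero_add,
      Category.assoc]
  · rw [ModuleCat.mono_iff_injective, injective_iff_map_eq_zero]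
    intro (z : Cochain Z M n) (hz : (Cochain.ofHom g).comp z (zero_add n) = 0)
    change z = 0
    ext p q hpq : 1
    have hz' := Cochain.congr_v hz p q hpq
    rw [Cochain.zero_cochain_comp_v, Cochain.ofHom_v, Cochain.zero_v] at hz'
    rw [← Category.id_comp (z.v p q hpq), ← hs, Category.assoc, hz', comp_zero, Cochain.zero_v]
  · rw [ModuleCat.epi_iff_surjective]
    intro (z : Cochain X M n)
    refine ⟨(Cochain.ofHoms r).comp z (zero_add n), ?_⟩
    change (Cochain.ofHom f).comp ((Cochain.ofHoms r).comp z (zero_add n))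
      (zero_add n) = z
    ext p q hpq : 1
    rw [Cochain.zero_cochain_comp_v, Cochain.zero_cochain_comp_v, Cochain.ofHom_v,
      Cochain.ofHoms_v, ← Category.assoc, hr, Category.id_comp]

end Precomp

/-! ### Exchanging the two variables -/

section Exchange

open CochainComplex HomComplex

variable {R : Type u} [CommRing R] {X Y M : CochainComplex (ModuleCat.{u} R) ℤ}

/-- The value at `x` and `y` of a cochain in `Hom_R(X, Hom_R(Y, M))`. -/
noncomputable def homEval {n : ℤ} (z : Cochain X ((homFunctor Y).obj M) n) (p q m k : ℤ) (hm : p + n = m)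
    (hk : q + m = k) : X.X p →ₗ[R] Y.X q →ₗ[R] M.X k where
  toFun x := (Cochain.v (z.v p m hm x : Cochain Y M m) q k hk).hom
  map_add' x x' := by rw [map_add]; rfl
  map_smul' a x := by rw [map_smul]; rfl

lemma ext_homEval {n : ℤ} {z z' : Cochain X ((homFunctor Y).obj M) n}
    (h : ∀ p q m k hm hk x y, homEval z p q m k hm hk x y = homEval z' p q m k hm hk x y) :
    z = z' := by
  ext p m hm x : 3
  refine Cochain.ext _ _ fun q k hk => ?_
  ext y
  exact h p q m k hm hk x y

/-- The outer differential contributes the term in `X` and the differential of `Hom(Y, M)`, and the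
latter splits into the terms in `M` and `Y`. -/
lemma homEval_δ {n : ℤ} (z : Cochain X ((homFunctor Y).obj M) n) (p q m k m' k' : ℤ)
    (hm : p + n = m) (hk : q + m = k) (hm' : p + (n + 1) = m') (hk' : q + m' = k')
    (x : X.X p) (y : Y.X q) :
    homEval (δ n (n + 1) z) p q m' k' hm' hk' x y =
      M.d k k' (homEval z p q m k hm hk x y) +
      m'.negOnePow • homEval z p (q + 1) m k' hm (by lia) x (Y.d q (q + 1) y) +
      (n + 1).negOnePow • homEval z (p + 1) q m' k' (by lia) hk' (X.d p (p + 1) x) y := by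
  obtain rfl : m' = m + 1 := by lia
  obtain ⟨a, ha⟩ : ∃ a : Cochain Y M m, a = z.v p m hm x := ⟨_, rfl⟩
  obtain ⟨b, hb⟩ : ∃ b : Cochain Y M (m + 1),
    b = z.v (p + 1) (m + 1) (by lia) (X.d p (p + 1) x) := ⟨_, rfl⟩
  obtain ⟨c, hc⟩ : ∃ c : Cochain Y M (m + 1), c = (δ n (n + 1) z).v p (m + 1) hm' x := ⟨_, rfl⟩
  have h₁ : c = δ m (m + 1) a + (n + 1).negOnePow • b := by
    rw [hc, δ_v n (n + 1) rfl z p (m + 1) hm' m (p + 1) (by lia) rfl]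
    obtain h | h := Int.units_eq_one_or (n + 1).negOnePow <;> rw [h]
    · rw [one_smul, one_smul, ha, hb]
      rfl
    · rw [Units.neg_smul, Units.neg_smul, one_smul, one_smul, ha, hb]
      rfl
  have e₁ : homEval (δ n (n + 1) z) p q (m + 1) k' hm' hk' x y = c.v q k' hk' y := by
    rw [hc]; rfl
  have e₂ : homEval z p q m k hm hk x y = a.v q k hk y := by
    rw [ha]; rfl
  have e₃ : homEval z p (q + 1) m k' hm (by lia) x (Y.d q (q + 1) y) =
      a.v (q + 1) k' (by lia) (Y.d q (q + 1) y) := by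
    rw [ha]; rfl
  have e₄ : homEval z (p + 1) q (m + 1) k' (by lia) hk' (X.d p (p + 1) x) y =
      b.v q k' hk' y := by
    rw [hb]; rfl
  rw [e₁, e₂, e₃, e₄, h₁, Cochain.add_v, Cochain.units_smul_v,
    δ_v m (m + 1) rfl _ q k' hk' k (q + 1) (by lia) rfl]
  obtain h | h := Int.units_eq_one_or (n + 1).negOnePow <;>
  obtain h' | h' := Int.units_eq_one_or (m + 1).negOnePow <;>
  simp only [h, h', Units.neg_smul, one_smul] <;> rfl

/-- The isomorphism `Hom_R(X, Hom_R(Y, M)) ≅ Hom_R(Y, Hom_R(X, M))`. -/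
noncomputable def homExchange {n : ℤ} (z : Cochain X ((homFunctor Y).obj M) n) :
    Cochain Y ((homFunctor X).obj M) n :=
  Cochain.mk fun q m hm => ModuleCat.ofHom
    { toFun y := Cochain.mk fun p k hk =>
        -- The Koszul sign for interchanging arguments of degrees `p` and `q`; it is what makes the
        -- exchange commute with the differentials.
        (p * q).negOnePow • ModuleCat.ofHom
          ((homEval z p q (p + n) k rfl (by lia)).flip y)
      map_add' y y' := by
        refine Cochain.ext _ _ fun p k hk => ?_
        simp [Cochain.mk_v]
      map_smul' a y := by
        refine Cochain.ext _ _ fun p k hk => ?_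
        simp only [Cochain.mk_v, map_smul, Cochain.smul_v, RingHom.id_apply]
        exact smul_comm ((p * q).negOnePow : ℤˣ) a (ModuleCat.ofHom
          ((homEval z p q (p + n) k rfl (by lia)).flip y)) }

lemma homEval_homExchange {n : ℤ} (z : Cochain X ((homFunctor Y).obj M) n) (p q m m' k : ℤ)
    (hm : q + n = m) (hk : p + m = k) (hm' : p + n = m') (x : X.X p) (y : Y.X q) :
    homEval (homExchange z) q p m k hm hk y x =
      (p * q).negOnePow • homEval z p q m' k hm' (by lia) x y := by
  subst hm'
  change ((p * q).negOnePow • ModuleCat.ofHom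
    ((homEval z p q (p + n) k rfl (by lia)).flip y)) x = _
  obtain h | h := Int.units_eq_one_or (p * q).negOnePow <;>
    simp only [h, Units.neg_smul, one_smul] <;> rfl

lemma homExchange_homExchange {n : ℤ} (z : Cochain X ((homFunctor Y).obj M) n) :
    homExchange (homExchange z) = z := by
  refine ext_homEval fun p q m k hm hk x y => ?_
  rw [homEval_homExchange _ q p m (q + n) k hm hk rfl,
    homEval_homExchange _ p q (q + n) m k rfl (by lia) hm, smul_smul, mul_comm q p,
    Int.units_mul_self, one_smul]

lemma δ_homExchange {n : ℤ} (z : Cochain X ((homFunctor Y).obj M) n) :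
    δ n (n + 1) (homExchange z) = homExchange (δ n (n + 1) z) := by
  refine ext_homEval fun q p m' k' hm hk y x => ?_
  rw [homEval_δ _ q p (q + n) (k' - 1) m' k' rfl (by lia) hm hk,
    homEval_homExchange _ p q m' (p + (n + 1)) k' hm hk rfl,
    homEval_δ _ p q (p + n) (k' - 1) _ k' rfl (by lia) rfl (by lia),
    homEval_homExchange _ p q (q + n) (p + n) (k' - 1) _ _ rfl,
    homEval_homExchange _ (p + 1) q (q + n) (p + (n + 1)) k' _ _ (by lia),
    homEval_homExchange _ p (q + 1) m' (p + n) k' _ _ rfl]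
  have h₁ : (q + (n + 1)).negOnePow * ((p + 1) * q).negOnePow =
      (p * q).negOnePow * (n + 1).negOnePow := by
    rw [← Int.negOnePow_add, ← Int.negOnePow_add, Int.negOnePow_eq_iff]
    exact ⟨q, by ring⟩
  have h₂ : (n + 1).negOnePow * (p * (q + 1)).negOnePow =
      (p * q).negOnePow * (p + (n + 1)).negOnePow := by
    rw [← Int.negOnePow_add, ← Int.negOnePow_add]
    congr 1
    ring
  subst hm
  rw [smul_add, smul_add, smul_smul, smul_smul, smul_smul, smul_smul, h₁, h₂,
    add_right_comm]
  congr 2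
  obtain h | h := Int.units_eq_one_or (p * q).negOnePow <;>
    simp only [h, Units.neg_smul, one_smul, map_neg]

/-- The exchange is an involution commuting with differentials, so a cocycle is bounded by
exchanging it, bounding the result, and exchanging back. -/
lemma isZero_homology_homFunctor_homFunctor (n : ℤ)
    (h : IsZero (((homFunctor X).obj ((homFunctor Y).obj M)).homology n)) :
    IsZero (((homFunctor Y).obj ((homFunctor X).obj M)).homology n) := by
  rw [isZero_homology_iff] at h ⊢
  intro (z : Cochain Y ((homFunctor X).obj M) n) (hz : δ n (n + 1) z = 0)
  have h₀ : homExchange (0 : Cochain Y ((homFunctor X).obj M) (n + 1)) = 0 := by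
    refine ext_homEval fun p q m' k' hm hk y x => ?_
    rw [homEval_homExchange _ _ _ _ _ _ _ _ rfl]
    exact smul_zero _
  have h₂ : δ n (n + 1) (homExchange z) = 0 := by
    rw [δ_homExchange, hz, h₀]
  obtain ⟨(y : Cochain X ((homFunctor Y).obj M) (n - 1)), (hy : δ (n - 1) n y = _)⟩ :=
    h (homExchange z) h₂
  refine ⟨homExchange y, ?_⟩
  change δ (n - 1) n (homExchange y) = z
  -- `δ_homExchange` concerns degrees of the form `m` and `m + 1`, while `n - 1 + 1` is not `n` by
  -- definition.
  obtain ⟨m, rfl⟩ : ∃ m, n = m + 1 := ⟨n - 1, by lia⟩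
  generalize hm : m + 1 - 1 = m' at *
  obtain rfl : m' = m := by lia
  rw [δ_homExchange, hy, homExchange_homExchange]

end Exchange

/-! ### The complexes `P₀ ⟶ P₁` and `R ⊕ P₀ ⟶ P₁` -/

section EvalOne

open CochainComplex HomComplex HomologicalComplex

variable (R : Type u) [CommRing R]

/-- The complex `R` in degree `0`. -/
noncomputable abbrev unitComplex : CochainComplex (ModuleCat.{u} R) ℤ :=
  (single (ModuleCat.{u} R) (ComplexShape.up ℤ) 0).obj (ModuleCat.of R R)

/-- The canonical map `Hom_R(R, M) ⟶ M`. -/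
noncomputable def evalOne : homFunctor (unitComplex R) ⟶ 𝟭 (CochainComplex (ModuleCat.{u} R) ℤ) where
  app M :=
    { f n := ModuleCat.ofHom
        { toFun z := Cochain.v z 0 n (zero_add n)
            ((singleObjXSelf (ComplexShape.up ℤ) 0 (ModuleCat.of R R)).inv (1 : R))
          map_add' _ _ := rfl
          map_smul' _ _ := rfl }
      comm' i j hij := by
        obtain rfl : i + 1 = j := hij
        refine ModuleCat.hom_ext (LinearMap.ext ?_)
        intro (z : Cochain (unitComplex R) M i)
        change M.d i (i + 1) _ = (δ i (i + 1) z).v 0 (i + 1) (zero_add _) _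
        rw [δ_v i (i + 1) rfl z 0 (i + 1) (zero_add _) i 1 (by lia) rfl,
          single_obj_d, zero_comp, smul_zero, add_zero]
        rfl }
  naturality M N f := by
    refine HomologicalComplex.hom_ext _ _ fun n => ModuleCat.hom_ext (LinearMap.ext ?_)
    intro (z : Cochain (unitComplex R) M n)
    change (z.comp (Cochain.ofHom f) (add_zero n)).v 0 n (zero_add n) _ = f.f n _
    rw [Cochain.comp_zero_cochain_v]
    rfl

/-- A cochain on `R` concentrated in degree `0` is determined by its value at `1`, which is
arbitrary. -/
lemma isIso_evalOne_app_f (M : CochainComplex (ModuleCat.{u} R) ℤ) (n : ℤ) :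
    IsIso (((evalOne R).app M).f n) := by
  rw [ConcreteCategory.isIso_iff_bijective]
  constructor
  · rw [injective_iff_map_eq_zero]
    intro (z : Cochain (unitComplex R) M n) hz
    change z = 0
    have h : (singleObjXSelf (ComplexShape.up ℤ) 0 (ModuleCat.of R R)).inv ≫
        Cochain.v z 0 n (zero_add n) = 0 := ModuleCat.hom_ext (LinearMap.ext_ring hz)
    ext p q hpq : 1
    by_cases hp : p = 0
    · obtain rfl : q = n := by lia
      subst hp
      rw [← cancel_epi (singleObjXSelf (ComplexShape.up ℤ) 0 (ModuleCat.of R R)).inv, h,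
        Cochain.zero_v, comp_zero]
    · exact (isZero_single_obj_X _ _ _ _ hp).eq_of_src _ _
  · intro (x : M.X n)
    let z : Cochain (unitComplex R) M n :=
      Cochain.fromSingleMk (ModuleCat.ofHom (LinearMap.toSpanSingleton R _ x)) (zero_add n)
    have h : (singleObjXSelf (ComplexShape.up ℤ) 0 (ModuleCat.of R R)).inv ≫
        z.v 0 n (zero_add n) = ModuleCat.ofHom (LinearMap.toSpanSingleton R _ x) := by
      rw [Iso.inv_comp_eq]
      exact Cochain.fromSingleMk_v _ _
    exact ⟨z, (ConcreteCategory.congr_hom h (1 : R)).trans (one_smul R x)⟩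

instance : IsIso (evalOne R) := by
  have (M : CochainComplex (ModuleCat.{u} R) ℤ) : IsIso ((evalOne R).app M) := by
    have := isIso_evalOne_app_f R M
    exact HomologicalComplex.Hom.isIso_of_components _
  exact NatIso.isIso_of_isIso_app _

end EvalOne

/-! ### Splitting, K-projectivity and cohomology of the two complexes -/

section Resolution

open CochainComplex HomComplex HomologicalComplex

variable {R : Type u} [CommRing R] {S : Submonoid R} (P : LocResolution S)

namespace LocResolution

/-- The complex `P₀ ⟶ P₁` in degrees `0` and `1`. -/
noncomputable def complexP : CochainComplex (ModuleCat.{u} R) ℤ :=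
  double (c := ComplexShape.up ℤ) (i₀ := 0) (i₁ := 1) P.d (by simp)

/-- The component of degree `0` of `P₀ ⟶ P₁`. -/
noncomputable def complexPIso₀ : P.complexP.X 0 ≅ P.P₀ := doubleXIso₀ _ _

/-- The component of degree `1` of `P₀ ⟶ P₁`. -/
noncomputable def complexPIso₁ : P.complexP.X 1 ≅ P.P₁ := doubleXIso₁ _ _ (by lia)

/-- The component of degree `0` of `R ⊕ P₀ ⟶ P₁`. -/
noncomputable def complexTIso₀ : P.complexT.X 0 ≅ ModuleCat.of R R ⊞ P.P₀ := doubleXIso₀ _ _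

/-- The component of degree `1` of `R ⊕ P₀ ⟶ P₁`. -/
noncomputable def complexTIso₁ : P.complexT.X 1 ≅ P.P₁ := doubleXIso₁ _ _ (by lia)

lemma complexP_d : P.complexP.d 0 1 = P.complexPIso₀.hom ≫ P.d ≫ P.complexPIso₁.inv :=
  double_d _ _ _

lemma complexT_d : P.complexT.d 0 1 =
    P.complexTIso₀.hom ≫ biprod.desc P.lift P.d ≫ P.complexTIso₁.inv :=
  double_d _ _ _

variable {P} in
lemma isZero_complexP {n : ℤ} (h₀ : n ≠ 0) (h₁ : n ≠ 1) : IsZero (P.complexP.X n) :=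
  isZero_double_X _ _ n h₀ h₁

variable {P} in
lemma isZero_complexT {n : ℤ} (h₀ : n ≠ 0) (h₁ : n ≠ 1) : IsZero (P.complexT.X n) :=
  isZero_double_X _ _ n h₀ h₁

/-- The inclusion of the complex `P₀ ⟶ P₁` in the complex `R ⊕ P₀ ⟶ P₁`. -/
noncomputable def inclT : P.complexP ⟶ P.complexT :=
  mkHomFromDouble _ (by lia) (biprod.inr ≫ P.complexTIso₀.inv) P.complexTIso₁.inv
    (by simp [complexT_d])
    (fun k hk => (isZero_complexT (by simp at hk; lia) (by simp at hk; lia)).eq_of_tgt _ _)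

lemma inclT_f_zero :
    P.inclT.f 0 = P.complexPIso₀.hom ≫ biprod.inr ≫ P.complexTIso₀.inv :=
  mkHomFromDouble_f₀ _ _ _ _ _ _

lemma inclT_f_one : P.inclT.f 1 = P.complexPIso₁.hom ≫ P.complexTIso₁.inv :=
  mkHomFromDouble_f₁ _ _ _ _ _ _

/-- The projection of the complex `R ⊕ P₀ ⟶ P₁` to `R`. -/
noncomputable def projT : P.complexT ⟶ unitComplex R :=
  mkHomToSingle (P.complexTIso₀.hom ≫ biprod.fst)
    (fun i hi => (isZero_complexT (by simp at hi; lia) (by simp at hi; lia)).eq_of_src _ _)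

lemma projT_f_zero : P.projT.f 0 =
    (P.complexTIso₀.hom ≫ biprod.fst) ≫ (singleObjXSelf _ 0 _).inv :=
  mkHomToSingle_f _ _

variable (S) in
/-- The complex `S⁻¹R` in degree `1`. -/
noncomputable abbrev locComplex : CochainComplex (ModuleCat.{u} R) ℤ :=
  (single (ModuleCat.{u} R) (ComplexShape.up ℤ) 1).obj (loc S)

variable (S) in
lemma isZero_locComplex {n : ℤ} (h : n ≠ 1) : IsZero ((locComplex S).X n) :=
  isZero_single_obj_X _ _ _ _ h

/-- The augmentation of the complex `P₀ ⟶ P₁`. -/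
noncomputable def augP : P.complexP ⟶ locComplex S :=
  mkHomToSingle (P.complexPIso₁.hom ≫ P.aug) (by
    intro i hi
    obtain rfl : i = 0 := by simp at hi; lia
    simp [complexP_d, P.d_aug])

lemma augP_f_one : P.augP.f 1 = (P.complexPIso₁.hom ≫ P.aug) ≫ (singleObjXSelf _ 1 _).inv :=
  mkHomToSingle_f _ _

/-- Degree `0` is the biproduct splitting, degree `1` involves only `P₁`, and all other terms
vanish. -/
lemma exists_splitting (n : ℤ) :
    ∃ (s : (unitComplex R).X n ⟶ P.complexT.X n) (r : P.complexT.X n ⟶ P.complexP.X n),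
      P.inclT.f n ≫ r = 𝟙 _ ∧ s ≫ P.projT.f n = 𝟙 _ ∧
        r ≫ P.inclT.f n + P.projT.f n ≫ s = 𝟙 _ := by
  by_cases h₀ : n = 0
  · subst h₀
    refine ⟨(singleObjXSelf _ _ _).hom ≫ biprod.inl ≫ P.complexTIso₀.inv,
      P.complexTIso₀.hom ≫ biprod.snd ≫ P.complexPIso₀.inv, ?_, ?_, ?_⟩
    · simp [inclT_f_zero]
    · simp [projT_f_zero]
    · have : P.complexTIso₀.hom ≫ (biprod.fst ≫ biprod.inl + biprod.snd ≫ biprod.inr) ≫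
          P.complexTIso₀.inv = 𝟙 _ := by simp
      rw [← this, inclT_f_zero, projT_f_zero]
      simp [add_comm]
  by_cases h₁ : n = 1
  · subst h₁
    refine ⟨0, P.complexTIso₁.hom ≫ P.complexPIso₁.inv, ?_, ?_, ?_⟩
    · simp [inclT_f_one]
    · exact (isZero_single_obj_X _ _ _ _ (by lia)).eq_of_src _ _
    · simp [inclT_f_one]
  · refine ⟨0, 0, ?_, ?_, ?_⟩
    · exact (isZero_complexP h₀ h₁).eq_of_src _ _
    · exact (isZero_single_obj_X _ _ _ _ h₀).eq_of_src _ _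
    · exact (isZero_complexT h₀ h₁).eq_of_src _ _

lemma inclT_projT : P.inclT ≫ P.projT = 0 :=
  to_single_hom_ext (by simp [inclT_f_zero, projT_f_zero])

instance : P.complexP.IsStrictlyLE 1 := by
  rw [isStrictlyLE_iff]
  exact fun i hi => isZero_complexP (by lia) (by lia)

instance : P.complexT.IsStrictlyLE 1 := by
  rw [isStrictlyLE_iff]
  exact fun i hi => isZero_complexT (by lia) (by lia)

instance : P.complexT.IsStrictlyGE 0 := by
  rw [isStrictlyGE_iff]
  exact fun i hi => isZero_complexT (by lia) (by lia)

instance : P.complexP.IsKProjective := by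
  have := P.projective₀
  have := P.projective₁
  have (n : ℤ) : Projective (P.complexP.X n) := by
    by_cases h₀ : n = 0
    · subst h₀
      exact Projective.of_iso P.complexPIso₀.symm inferInstance
    by_cases h₁ : n = 1
    · subst h₁
      exact Projective.of_iso P.complexPIso₁.symm inferInstance
    · exact (isZero_complexP h₀ h₁).projective
  exact isKProjective_of_projective _ 1

instance : P.complexT.IsKProjective := by
  have := P.projective₀
  have := P.projective₁
  have : Projective (ModuleCat.of R R) :=
    (IsProjective.iff_projective (ModuleCat.of R R)).1 inferInstance
  have (n : ℤ) : Projective (P.complexT.X n) := by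
    by_cases h₀ : n = 0
    · subst h₀
      exact Projective.of_iso P.complexTIso₀.symm inferInstance
    by_cases h₁ : n = 1
    · subst h₁
      exact Projective.of_iso P.complexTIso₁.symm inferInstance
    · exact (isZero_complexT h₀ h₁).projective
  exact isKProjective_of_projective _ 1

instance : QuasiIso P.augP := by
  have hT := P.shortExact
  have := hT.mono_f
  have := hT.epi_g
  rw [quasiIso_iff]
  intro n
  by_cases h₁ : n = 1
  · subst h₁
    rw [quasiIsoAt_iff' _ 0 1 2 (by simp) (by simp), ShortComplex.quasiIso_iff_of_zeros']
    · refine ⟨?_, ?_⟩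
      · refine ShortComplex.exact_of_iso
          (ShortComplex.isoMk P.complexPIso₀.symm P.complexPIso₁.symm
            (singleObjXSelf (ComplexShape.up ℤ) 1 (loc S)).symm ?_ ?_) hT.exact
        · change P.complexPIso₀.inv ≫ P.complexP.d 0 1 = P.d ≫ P.complexPIso₁.inv
          simp [complexP_d]
        · change P.complexPIso₁.inv ≫ P.augP.f 1 = P.aug ≫ (singleObjXSelf _ 1 _).inv
          simp [augP_f_one]
      · change Epi (P.augP.f 1)
        rw [augP_f_one]
        infer_instance
    · exact (isZero_complexP (by lia) (by lia)).eq_of_tgt _ _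
    · exact (isZero_locComplex S (by lia : (0 : ℤ) ≠ 1)).eq_of_src _ _
    · exact (isZero_locComplex S (by lia : (2 : ℤ) ≠ 1)).eq_of_tgt _ _
  · have h' : (locComplex S).ExactAt n := ExactAt.of_isZero (isZero_locComplex S h₁)
    rw [quasiIsoAt_iff_exactAt' _ _ h']
    by_cases h₀ : n = 0
    · subst h₀
      rw [exactAt_iff' _ (-1) 0 1 (by simp) (by simp), ShortComplex.exact_iff_mono]
      · change Mono (P.complexP.d 0 1)
        rw [complexP_d]
        infer_instance
      · exact (isZero_complexP (by lia) (by lia)).eq_of_src _ _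
    · exact ExactAt.of_isZero (isZero_complexP h₀ h₁)

/-- Morally `T` is the cocone of `R ⟶ S⁻¹R`, whose cohomology is the kernel and the cokernel of that
map, both torsion. The proof carries this out with elements. -/
lemma tors_homology_complexT (n : ℤ) : tors S (P.complexT.homology n) := by
  have hT := P.shortExact
  have hd : Function.Injective P.d := (ModuleCat.mono_iff_injective _).1 hT.mono_f
  have haug (r : R) : P.aug (P.lift r) = algebraMap R (Localization S) r :=
    ConcreteCategory.congr_hom P.lift_aug r
  have haug' (p : P.P₀) : P.aug (P.d p) = 0 := ConcreteCategory.congr_hom P.d_aug p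
  have hdesc (y : (ModuleCat.of R R ⊞ P.P₀ : ModuleCat R)) : biprod.desc P.lift P.d y =
      P.lift (biprod.fst (Y := P.P₀) y) + P.d (biprod.snd (X := ModuleCat.of R R) y) :=
    ConcreteCategory.congr_hom (biprod.desc_eq (f := P.lift) (g := P.d)) y
  have htotal (y : (ModuleCat.of R R ⊞ P.P₀ : ModuleCat R)) : y =
      biprod.inl (Y := P.P₀) (biprod.fst (Y := P.P₀) y) +
        biprod.inr (X := ModuleCat.of R R) (biprod.snd (X := ModuleCat.of R R) y) :=
    (ConcreteCategory.congr_hom (biprod.total (X := ModuleCat.of R R) (Y := P.P₀)) y).symm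
  rw [tors_homology_iff]
  by_cases h₀ : n = 0
  · subst h₀
    intro x hx
    obtain ⟨y, rfl⟩ : ∃ y, x = P.complexTIso₀.inv y := ⟨P.complexTIso₀.hom x, by simp⟩
    have hy : P.complexTIso₁.inv (biprod.desc P.lift P.d y) = 0 := by
      replace hx : P.complexT.d 0 1 (P.complexTIso₀.inv y) = 0 := hx
      rw [complexT_d] at hx
      simpa using hx
    have hy' : biprod.desc P.lift P.d y = 0 := by
      rw [← map_zero P.complexTIso₁.inv.hom] at hy
      exact (ModuleCat.mono_iff_injective P.complexTIso₁.inv).1 inferInstance hy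
    rw [hdesc] at hy'
    -- Applying `aug` to the cocycle equation shows that the `R`-component dies in `S⁻¹R`, hence is
    -- killed by some `s`; injectivity of `P.d` then makes `s` kill the `P₀`-component too.
    obtain ⟨⟨s, hs⟩, hs'⟩ := (IsLocalization.map_eq_zero_iff S (Localization S) _).1 (show
      algebraMap R (Localization S) (biprod.fst (Y := P.P₀) y) = 0 by
        rw [← haug, eq_neg_of_add_eq_zero_left hy', map_neg, haug', neg_zero])
    replace hs' : s • (biprod.fst (Y := P.P₀) y) = 0 := hs'
    have hp : s • (biprod.snd (X := ModuleCat.of R R) y) = 0 := by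
      apply hd
      have := congrArg (s • ·) hy'
      dsimp only at this
      rw [smul_add, ← map_smul, hs', map_zero, zero_add, smul_zero] at this
      rw [map_smul, this, map_zero]
    refine ⟨s, hs, 0, ?_⟩
    rw [← map_smul] at hs' hp
    rw [map_zero, ← map_smul, htotal (s • y), hs', hp, map_zero, map_zero, add_zero, map_zero]
  by_cases h₁ : n = 1
  · subst h₁
    intro x _
    obtain ⟨p, rfl⟩ : ∃ p, x = P.complexTIso₁.inv p := ⟨P.complexTIso₁.hom x, by simp⟩
    -- Writing the augmentation of `p` as a fraction `a / s` puts `s • p - P.lift a` in the kernel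
    -- of `aug`, that is, in the image of `P.d`.
    obtain ⟨⟨a, ⟨s, hs⟩⟩, hp⟩ := IsLocalization.surj S (show Localization S from P.aug p)
    replace hp : P.aug (s • p - P.lift a) = 0 := by
      rw [map_sub, map_smul, haug, sub_eq_zero, ← hp]
      exact (Algebra.smul_def s (show Localization S from P.aug p)).trans (mul_comm _ _)
    obtain ⟨q, hq⟩ := (ShortComplex.moduleCat_exact_iff _).1 hT.exact _ hp
    replace hq : P.d q = s • p - P.lift a := hq
    refine ⟨s, hs, P.complexTIso₀.inv (biprod.inl (X := ModuleCat.of R R) (Y := P.P₀) a +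
      biprod.inr (X := ModuleCat.of R R) (Y := P.P₀) q), ?_⟩
    change P.complexT.d 0 1 _ = _
    rw [complexT_d, ← map_smul]
    have h₁ : biprod.fst (Y := P.P₀) (biprod.inl (X := ModuleCat.of R R) (Y := P.P₀) a +
      biprod.inr (X := ModuleCat.of R R) (Y := P.P₀) q) = a := by
      rw [map_add, ← ConcreteCategory.comp_apply, ← ConcreteCategory.comp_apply, biprod.inl_fst,
        biprod.inr_fst]
      exact add_zero _
    have h₂ : biprod.snd (X := ModuleCat.of R R) (biprod.inl (X := ModuleCat.of R R) (Y := P.P₀) a +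
      biprod.inr (X := ModuleCat.of R R) (Y := P.P₀) q) = q := by
      rw [map_add, ← ConcreteCategory.comp_apply, ← ConcreteCategory.comp_apply, biprod.inl_snd,
        biprod.inr_snd]
      exact zero_add _
    simp [hdesc, h₁, h₂, hq]
  · intro x _
    exact ⟨1, S.one_mem, 0, by
      have := ModuleCat.subsingleton_of_isZero (P.isZero_complexT h₀ h₁)
      exact Subsingleton.elim _ _⟩

end LocResolution

end Resolution

/-! ### Morphisms from projective objects in the derived category -/

section ProjectiveHom

open HomologicalComplex

variable {C : Type u} [Category.{v} C] [Abelian C] [HasDerivedCategory.{w} C] (A : C) [Projective A]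

instance isKProjective_single :
    CochainComplex.IsKProjective ((single C (ComplexShape.up ℤ) 0).obj A) := by
  have : CochainComplex.IsStrictlyLE ((single C (ComplexShape.up ℤ) 0).obj A) 0 := by
    rw [CochainComplex.isStrictlyLE_iff]
    exact fun i hi => isZero_single_obj_X _ _ _ _ (by lia)
  have (n : ℤ) : Projective (((single C (ComplexShape.up ℤ) 0).obj A).X n) := by
    by_cases h : n = 0
    · subst h
      exact Projective.of_iso (singleObjXSelf (ComplexShape.up ℤ) 0 A).symm inferInstance
    · exact (isZero_single_obj_X _ _ _ _ h).projective
  exact CochainComplex.isKProjective_of_projective _ 0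

variable {A} {K : CochainComplex C ℤ}

omit [HasDerivedCategory.{w} C] in
-- Projectivity of `A` lifts a map into homology to a map into cycles.
lemma homologyMap_from_single_surjective
    (φ : ((single C (ComplexShape.up ℤ) 0).obj A).homology 0 ⟶ K.homology 0) :
    ∃ g : (single C (ComplexShape.up ℤ) 0).obj A ⟶ K, homologyMap g 0 = φ := by
  let l : A ⟶ K.cycles 0 := Projective.factorThru
    ((singleObjHomologySelfIso _ 0 A).inv ≫ φ) (K.homologyπ 0)
  have hl : l ≫ K.homologyπ 0 = (singleObjHomologySelfIso _ 0 A).inv ≫ φ :=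
    Projective.factorThru_comp _ _
  let g : (single C (ComplexShape.up ℤ) 0).obj A ⟶ K :=
    mkHomFromSingle (l ≫ K.iCycles 0) (by intros; simp)
  refine ⟨g, ?_⟩
  have hg : cyclesMap g 0 = (singleObjCyclesSelfIso _ 0 A).hom ≫ l := by
    rw [← cancel_mono (K.iCycles 0), cyclesMap_i, mkHomFromSingle_f, singleObjCyclesSelfIso_hom]
    simp
  rw [← cancel_epi (homologyπ _ 0), homologyπ_naturality, hg, Category.assoc, hl,
    ← homologyπ_singleObjHomologySelfIso_hom]
  simp

omit [HasDerivedCategory.{w} C] in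
lemma homotopic_zero_of_homologyMap_eq_zero (g : (single C (ComplexShape.up ℤ) 0).obj A ⟶ K)
    (hg : homologyMap g 0 = 0) : Nonempty (Homotopy g 0) := by
  obtain ⟨φ, hφ, rfl⟩ : ∃ (φ : A ⟶ K.X 0) (hφ : ∀ i, (ComplexShape.up ℤ).Rel 0 i → φ ≫ K.d 0 i = 0),
      g = mkHomFromSingle φ hφ := by
    refine ⟨(singleObjXSelf _ 0 A).inv ≫ g.f 0, fun i _ => ?_, ?_⟩
    · rw [Category.assoc, g.comm, single_obj_d, zero_comp, comp_zero]
    · refine from_single_hom_ext ?_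
      simp
  let l := K.liftCycles φ 1 (by simp) (hφ 1 (by simp))
  have hl : l ≫ K.homologyπ 0 = 0 := by
    have : (singleObjCyclesSelfIso _ 0 A).hom ≫ l = cyclesMap (mkHomFromSingle φ hφ) 0 := by
      rw [← cancel_mono (K.iCycles 0), cyclesMap_i, mkHomFromSingle_f, singleObjCyclesSelfIso_hom]
      simp [l]
    rw [← cancel_epi (singleObjCyclesSelfIso (ComplexShape.up ℤ) 0 A).hom, ← Category.assoc, this,
      ← homologyπ_naturality, hg, comp_zero, comp_zero]
  have hex : (ShortComplex.mk _ _ (K.toCycles_comp_homologyπ (-1) 0)).Exact :=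
    ShortComplex.exact_of_g_is_cokernel _ (K.homologyIsCokernel (-1) 0 (by simp))
  -- The map lands in boundaries, so projectivity lifts it to `K.X (-1)`; this lift is the homotopy.
  let h : A ⟶ K.X (-1) := hex.liftFromProjective l hl
  have hh : h ≫ K.d (-1) 0 = φ := by
    rw [← K.toCycles_i (-1) 0, ← Category.assoc, hex.liftFromProjective_comp l hl]
    simp [l]
  let y : CochainComplex.HomComplex.Cochain ((single C (ComplexShape.up ℤ) 0).obj A) K (-1) :=
    CochainComplex.HomComplex.Cochain.fromSingleMk h (zero_add (-1))
  have hy : (CochainComplex.HomComplex.δ (-1) 0 y).v 0 0 (add_zero 0) =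
      (singleObjXSelf (ComplexShape.up ℤ) 0 A).hom ≫ φ := by
    have h₁ : CochainComplex.HomComplex.δ (-1) 0 y =
        CochainComplex.HomComplex.Cochain.fromSingleMk (h ≫ K.d (-1) 0) (add_zero 0) :=
      CochainComplex.HomComplex.Cochain.δ_fromSingleMk h (zero_add (-1)) 0 0 (add_zero 0)
    rw [h₁, hh]
    exact CochainComplex.HomComplex.Cochain.fromSingleMk_v _ _
  refine ⟨(CochainComplex.HomComplex.Cochain.equivHomotopy _ _).symm ⟨y, ?_⟩⟩
  rw [CochainComplex.HomComplex.Cochain.ofHom_zero, add_zero]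
  refine CochainComplex.HomComplex.Cochain.ext₀ _ _ fun p => ?_
  by_cases hp : p = 0
  · subst hp
    rw [hy, CochainComplex.HomComplex.Cochain.ofHom_v, mkHomFromSingle_f]
  · exact (isZero_single_obj_X _ _ _ _ hp).eq_of_src _ _

variable (A) in
-- Maps out of a projective object in degree `0` are homotopy classes of chain maps, and a class is
-- determined by the map on `H⁰`, which can be prescribed.
lemma homologyFunctor_map_bijective (X : DerivedCategory.{w} C) :
    Function.Bijective (fun f : (DerivedCategory.singleFunctor C 0).obj A ⟶ X =>
      (DerivedCategory.homologyFunctor C 0).map f) := by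
  obtain ⟨K, ⟨e⟩⟩ : ∃ K, Nonempty (DerivedCategory.Q.obj K ≅ X) :=
    ⟨_, ⟨DerivedCategory.Q.objObjPreimageIso X⟩⟩
  let L : CochainComplex C ℤ := (single C (ComplexShape.up ℤ) 0).obj A
  have hQ (g : L ⟶ K) : (DerivedCategory.homologyFunctor C 0).map (DerivedCategory.Q.map g) =
      (DerivedCategory.homologyFunctorFactors C 0).hom.app L ≫
        (homologyFunctor C (ComplexShape.up ℤ) 0).map g ≫
        (DerivedCategory.homologyFunctorFactors C 0).inv.app K :=
    (NatIso.naturality_2 (DerivedCategory.homologyFunctorFactors C 0) g).symm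
  have hsurj (f : DerivedCategory.Q.obj L ⟶ DerivedCategory.Q.obj K) :
      ∃ g, DerivedCategory.Q.map g = f := by
    obtain ⟨g, hg⟩ := (CochainComplex.IsKProjective.Qh_map_bijective L
      ((HomotopyCategory.quotient _ _).obj K)).2 f
    obtain ⟨g, rfl⟩ := (HomotopyCategory.quotient _ _).map_surjective g
    exact ⟨g, hg⟩
  have h₁ (f : DerivedCategory.Q.obj L ⟶ DerivedCategory.Q.obj K)
      (hf : (DerivedCategory.homologyFunctor C 0).map f = 0) : f = 0 := by
    obtain ⟨g, rfl⟩ := hsurj f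
    rw [hQ, ← cancel_epi ((DerivedCategory.homologyFunctorFactors C 0).inv.app L),
      ← cancel_mono ((DerivedCategory.homologyFunctorFactors C 0).hom.app K)] at hf
    simp only [Iso.inv_hom_id_app_assoc, comp_zero, zero_comp, Category.assoc, Iso.inv_hom_id_app,
      Category.comp_id] at hf
    obtain ⟨H⟩ := homotopic_zero_of_homologyMap_eq_zero g hf
    rw [← DerivedCategory.Q.map_zero]
    exact congrArg DerivedCategory.Qh.map (HomotopyCategory.eq_of_homotopy _ _ H)
  have h₂ (φ : (DerivedCategory.homologyFunctor C 0).obj (DerivedCategory.Q.obj L) ⟶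
      (DerivedCategory.homologyFunctor C 0).obj (DerivedCategory.Q.obj K)) :
      ∃ f, (DerivedCategory.homologyFunctor C 0).map f = φ := by
    obtain ⟨g, hg⟩ := homologyMap_from_single_surjective
      ((DerivedCategory.homologyFunctorFactors C 0).inv.app L ≫ φ ≫
        (DerivedCategory.homologyFunctorFactors C 0).hom.app K)
    refine ⟨DerivedCategory.Q.map g, ?_⟩
    replace hg : (homologyFunctor C (ComplexShape.up ℤ) 0).map g =
      (DerivedCategory.homologyFunctorFactors C 0).inv.app L ≫ φ ≫
        (DerivedCategory.homologyFunctorFactors C 0).hom.app K := hg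
    rw [hQ, hg]
    simp
  have h₁' (f : (DerivedCategory.singleFunctor C 0).obj A ⟶ DerivedCategory.Q.obj K)
      (hf : (DerivedCategory.homologyFunctor C 0).map f = 0) : f = 0 := h₁ f hf
  have h₂' (φ : (DerivedCategory.homologyFunctor C 0).obj
      ((DerivedCategory.singleFunctor C 0).obj A) ⟶
      (DerivedCategory.homologyFunctor C 0).obj (DerivedCategory.Q.obj K)) :
      ∃ f : (DerivedCategory.singleFunctor C 0).obj A ⟶ DerivedCategory.Q.obj K,
        (DerivedCategory.homologyFunctor C 0).map f = φ := h₂ φ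
  constructor
  · intro f f' (hf : (DerivedCategory.homologyFunctor C 0).map f =
      (DerivedCategory.homologyFunctor C 0).map f')
    rw [← sub_eq_zero, ← cancel_mono e.inv, zero_comp]
    exact h₁' _ (by rw [Functor.map_comp, Functor.map_sub, hf, sub_self, zero_comp])
  · intro φ
    obtain ⟨f, hf⟩ := h₂' (φ ≫ (DerivedCategory.homologyFunctor C 0).map e.inv)
    refine ⟨f ≫ e.hom, ?_⟩
    dsimp only
    rw [Functor.map_comp, hf, Category.assoc, ← Functor.map_comp, e.inv_hom_id,
      CategoryTheory.Functor.map_id, Category.comp_id]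

end ProjectiveHom

/-! ### Morphisms from the cone of a morphism -/

section Cone

variable {T : Type u} [Category.{v} T] [Preadditive T] [HasZeroObject T] [HasShift T ℤ]
  [∀ n : ℤ, (shiftFunctor T n).Additive] [Pretriangulated T]

/-- This is the long exact sequence of `Hom(-, X)`. All degrees are needed together: vanishing in
degree `m + 1` uses injectivity there and surjectivity in degree `m`. -/
lemma forall_bijective_precomp_mor₁_iff {Δ : Triangle T} (hΔ : Δ ∈ distTriang T) (X : T) :
    (∀ n : ℤ, Function.Bijective (fun f : Δ.obj₂ ⟶ X⟦n⟧ => Δ.mor₁ ≫ f)) ↔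
      ∀ (n : ℤ) (f : Δ.obj₃ ⟶ X⟦n⟧), f = 0 := by
  constructor
  · intro hX n f
    obtain ⟨m, rfl⟩ : ∃ m, n = m + 1 := ⟨n - 1, by lia⟩
    have h₁ : Δ.mor₂ ≫ f = 0 := (hX (m + 1)).1 (by
      dsimp only
      rw [comp_distTriang_mor_zero₁₂_assoc _ hΔ, zero_comp, comp_zero])
    obtain ⟨g, rfl⟩ := Triangle.yoneda_exact₃ _ hΔ f h₁
    let ψ := (shiftFunctorAdd T m 1).app X
    obtain ⟨g', hg'⟩ := (shiftFunctor _ (1 : ℤ)).map_surjective (g ≫ ψ.hom)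
    obtain ⟨k, rfl⟩ := (hX m).2 g'
    have hg : g = Δ.mor₁⟦(1 : ℤ)⟧' ≫ k⟦(1 : ℤ)⟧' ≫ ψ.inv := by
      rw [← Category.assoc, Iso.eq_comp_inv, ← hg', ← Functor.map_comp]
    rw [hg, comp_distTriang_mor_zero₃₁_assoc _ hΔ, zero_comp]
  · intro hX n
    constructor
    · intro f f' (hf : _ ≫ f = _ ≫ f')
      rw [← sub_eq_zero, ← Preadditive.comp_sub] at hf
      obtain ⟨g, hg⟩ := Triangle.yoneda_exact₂ _ hΔ (f - f') hf
      rw [← sub_eq_zero, hg, hX n g, comp_zero]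
    · intro f
      let ψ := (shiftFunctorAdd T n 1).app X
      have h₁ : Δ.mor₃ ≫ f⟦(1 : ℤ)⟧' = 0 := by
        rw [← cancel_mono ψ.inv, zero_comp]
        exact hX (n + 1) _
      obtain ⟨(g : Δ.obj₂⟦(1 : ℤ)⟧ ⟶ X⟦n⟧⟦(1 : ℤ)⟧), hg⟩ :=
        Triangle.yoneda_exact₃ _ (rot_of_distTriang _ hΔ) (f⟦(1 : ℤ)⟧') h₁
      obtain ⟨k, rfl⟩ := (shiftFunctor _ (1 : ℤ)).map_surjective g
      -- The sign offsets the one that rotation puts on the shifted first morphism.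
      refine ⟨-k, (shiftFunctor _ (1 : ℤ)).map_injective ?_⟩
      dsimp only
      rw [hg, Functor.map_comp, Functor.map_neg, Preadditive.comp_neg, ← Preadditive.neg_comp]
      rfl

end Cone

/-! ### Contramodules and morphisms from `S⁻¹R` in the derived category -/

section Ctra

variable {R : Type u} [CommRing R] {S : Submonoid R} (P : LocResolution S)

/-- `Ext⁰` and `Ext¹` from `S⁻¹R` are the kernel and cokernel of precomposition with `P.d`. -/
lemma LocResolution.ctra_iff_bijective (M : ModuleCat.{u} R) :
    ctra S M ↔ Function.Bijective (fun f : P.P₁ ⟶ M => P.d ≫ f) := by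
  have hT := P.shortExact
  have := hT.mono_f
  have := hT.epi_g
  have := P.projective₀
  have := P.projective₁
  constructor
  · intro h
    constructor
    · intro f f' (hf : P.d ≫ f = P.d ≫ f')
      rw [← sub_eq_zero, ← Preadditive.comp_sub] at hf
      have := h 0 (by lia)
      have e : hT.exact.desc (f - f') hf = 0 :=
        Abelian.Ext.addEquiv₀.symm.injective (Subsingleton.elim _ _)
      rw [← sub_eq_zero, ← hT.exact.g_desc (f - f') hf, e, comp_zero]
    · intro f
      have := h 1 (by lia)
      obtain ⟨x, hx⟩ := Abelian.Ext.contravariant_sequence_exact₁ hT M (Abelian.Ext.mk₀ f)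
        (add_zero 1) (Subsingleton.elim _ _)
      obtain ⟨g, rfl⟩ := Abelian.Ext.addEquiv₀.symm.surjective x
      refine ⟨g, Abelian.Ext.addEquiv₀.symm.injective ?_⟩
      exact (Abelian.Ext.mk₀_comp_mk₀ _ _).symm.trans hx
  · intro h n hn
    refine subsingleton_of_forall_eq 0 fun x => ?_
    obtain rfl | rfl : n = 0 ∨ n = 1 := by lia
    · obtain ⟨f, rfl⟩ := Abelian.Ext.addEquiv₀.symm.surjective x
      have : P.aug ≫ f = 0 := h.1 (by
        dsimp only
        rw [reassoc_of% P.d_aug, zero_comp, comp_zero])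
      have : f = 0 := by
        rw [← cancel_epi P.aug, this, comp_zero]
      rw [this, map_zero]
    · obtain ⟨y, rfl⟩ := Abelian.Ext.contravariant_sequence_exact₃ hT M x
        (Abelian.Ext.eq_zero_of_projective _) (add_zero 1)
      obtain ⟨f, rfl⟩ := Abelian.Ext.addEquiv₀.symm.surjective y
      obtain ⟨g, rfl⟩ := h.2 f
      have : Abelian.Ext.addEquiv₀.symm (P.d ≫ g) =
        (Abelian.Ext.mk₀ P.d).comp (Abelian.Ext.mk₀ g) (zero_add 0) :=
        (Abelian.Ext.mk₀_comp_mk₀ _ _).symm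
      rw [this]
      exact hT.extClass_comp_assoc _

variable [HasDerivedCategory.{w} (ModuleCat.{u} R)]

lemma LocResolution.ctra_homology_zero_iff (X : DerivedCategory.{w} (ModuleCat.{u} R)) :
    ctra S ((DerivedCategory.homologyFunctor _ 0).obj X) ↔
      Function.Bijective (fun f : (DerivedCategory.singleFunctor _ 0).obj P.P₁ ⟶ X =>
        (DerivedCategory.singleFunctor _ 0).map P.d ≫ f) := by
  have := P.projective₀
  have := P.projective₁
  let θ := DerivedCategory.singleFunctorCompHomologyFunctorIso (ModuleCat.{u} R) 0
  have h (A : ModuleCat.{u} R) [Projective A] : Function.Bijective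
      (fun f : (DerivedCategory.singleFunctor _ 0).obj A ⟶ X =>
        θ.inv.app A ≫ (DerivedCategory.homologyFunctor _ 0).map f) :=
    (Iso.homFromEquiv (θ.app A)).bijective.comp (homologyFunctor_map_bijective A X)
  rw [P.ctra_iff_bijective, ← Function.Bijective.of_comp_iff _ (h P.P₁),
    ← Function.Bijective.of_comp_iff' (h P.P₀)]
  refine iff_of_eq (congrArg _ (funext fun f => ?_))
  simp only [Function.comp_apply, Functor.map_comp]
  exact (θ.inv.naturality_assoc P.d _)

/-- Since `P₀` and `P₁` are projective, maps from them to `X⟦n⟧` depend only on `Hⁿ(X)`. As `S⁻¹R`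
is the cone of `P.d`, the bijectivity criterion in all degrees is the vanishing of maps from `S⁻¹R`.
-/
lemma ctra_homology_iff [HasProjectiveDimensionLE (loc S) 1]
    (X : DerivedCategory.{w} (ModuleCat.{u} R)) :
    (∀ n, ctra S ((DerivedCategory.homologyFunctor _ n).obj X)) ↔
      ∀ (n : ℤ) (f : (DerivedCategory.singleFunctor _ 0).obj (loc S) ⟶ X⟦n⟧), f = 0 := by
  obtain ⟨P⟩ : Nonempty (LocResolution S) := inferInstance
  have h (n : ℤ) : ctra S ((DerivedCategory.homologyFunctor _ n).obj X) ↔ _ :=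
    ((ctra S).prop_iff_of_iso (((DerivedCategory.homologyFunctor _ 0).shiftIso n 0 n
      (add_zero n)).app X)).symm.trans (P.ctra_homology_zero_iff (X⟦n⟧))
  simp_rw [h]
  exact forall_bijective_precomp_mor₁_iff P.shortExact.singleTriangle_distinguished X

end Ctra

/-! ### Shift invariance of the vanishing of morphisms -/

section ShiftHom

variable {T : Type u} [Category.{v} T] [Preadditive T] [HasShift T ℤ]
  [∀ n : ℤ, (shiftFunctor T n).Additive]

lemma forall_hom_shift_eq_zero_iff (a : ℤ) (A X : T) :
    (∀ (n : ℤ) (f : A⟦a⟧ ⟶ X⟦n⟧), f = 0) ↔ ∀ (n : ℤ) (f : A ⟶ X⟦n⟧), f = 0 := by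
  constructor
  · intro h n f
    refine (shiftFunctor T a).map_injective ?_
    rw [← cancel_mono ((shiftFunctorAdd T n a).inv.app X), h _ (f⟦a⟧' ≫ _), Functor.map_zero,
      zero_comp]
  · intro h n f
    obtain ⟨m, rfl⟩ : ∃ m, n = m + a := ⟨n - a, by lia⟩
    obtain ⟨g, hg⟩ := (shiftFunctor T a).map_surjective (f ≫ (shiftFunctorAdd T m a).hom.app X)
    rw [← cancel_mono ((shiftFunctorAdd T m a).hom.app X), ← hg, h m g, Functor.map_zero,
      zero_comp]

end ShiftHom

lemma distinguished_of_iso_comp {T : Type u} [Category.{v} T] [Preadditive T] [HasZeroObject T]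
    [HasShift T ℤ] [∀ n : ℤ, (shiftFunctor T n).Additive] [Pretriangulated T] {A' A B C : T}
    {f : A ⟶ B} {g : B ⟶ C} {h : C ⟶ A⟦(1 : ℤ)⟧} (H : Triangle.mk f g h ∈ distTriang T)
    (e : A' ≅ A) : Triangle.mk (e.hom ≫ f) g (h ≫ e.inv⟦(1 : ℤ)⟧') ∈ distTriang T :=
  isomorphic_distinguished _ H _ (Triangle.isoMk _ _ e (Iso.refl B) (Iso.refl C)
    (Category.comp_id (e.hom ≫ f)) ((Category.comp_id g).trans (Category.id_comp g).symm) (by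
      change (h ≫ e.inv⟦(1 : ℤ)⟧') ≫ e.hom⟦(1 : ℤ)⟧' = 𝟙 C ≫ h
      rw [Category.assoc, ← Functor.map_comp, e.inv_hom_id, CategoryTheory.Functor.map_id,
        Category.comp_id,
        Category.id_comp]))

/-! ### The triangle of `M ⟶ Hom(T, M)` and orthogonality to local complexes -/

section HomUnit

open CochainComplex HomologicalComplex

variable {R : Type u} [CommRing R] {S : Submonoid R} (P : LocResolution S)

lemma isIso_smul_id_locComplex {s : R} (hs : s ∈ S) :
    IsIso (s • 𝟙 (LocResolution.locComplex S)) := by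
  have h : IsIso (s • 𝟙 (loc S)) := by
    rw [ConcreteCategory.isIso_iff_bijective]
    exact (Module.End.isUnit_iff _).1 (IsLocalizedModule.map_units (S := S)
      (Algebra.linearMap R (Localization S)) ⟨s, hs⟩)
  have (n : ℤ) : IsIso ((s • 𝟙 (LocResolution.locComplex S)).f n) := by
    by_cases hn : n = 1
    · subst hn
      have : (s • 𝟙 (LocResolution.locComplex S)).f 1 =
          (singleObjXSelf (ComplexShape.up ℤ) 1 (loc S)).hom ≫ (s • 𝟙 (loc S)) ≫
            (singleObjXSelf (ComplexShape.up ℤ) 1 (loc S)).inv := by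
        simp
      rw [this]
      infer_instance
    · exact (LocResolution.isZero_locComplex S hn).isIso (LocResolution.isZero_locComplex S hn) _
  exact Hom.isIso_of_components _

/-- The canonical map `M ⟶ Hom_R(T, M)`. -/
noncomputable def homUnit :
    𝟭 (CochainComplex (ModuleCat.{u} R) ℤ) ⟶ homFunctor P.complexT :=
  inv (evalOne R) ≫ homPrecomp P.projT

lemma isLocal_homology_shift {Y : CochainComplex (ModuleCat.{u} R) ℤ}
    (hY : ∀ m, isLocal S (Y.homology m)) (n m : ℤ) : isLocal S ((Y⟦n⟧).homology m) :=
  (isLocal S).prop_of_iso (((homologyFunctor (ModuleCat.{u} R) (ComplexShape.up ℤ) 0).shiftIso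
    n m (n + m) rfl).symm.app Y) (hY (n + m))

variable [HasDerivedCategory.{w} (ModuleCat.{u} R)]

lemma isIso_smul_id_Q_complexP {s : R} (hs : s ∈ S) :
    IsIso (s • 𝟙 (DerivedCategory.Q.obj P.complexP)) := by
  have := isIso_smul_id_locComplex hs
  have : s • 𝟙 (DerivedCategory.Q.obj P.complexP) = DerivedCategory.Q.map P.augP ≫
      DerivedCategory.Q.map (s • 𝟙 (LocResolution.locComplex S)) ≫
        inv (DerivedCategory.Q.map P.augP) := by
    rw [Functor.map_smul, CategoryTheory.Functor.map_id, Linear.smul_comp, Category.id_comp,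
      Linear.comp_smul, IsIso.hom_inv_id]
  rw [this]
  infer_instance

omit [HasDerivedCategory.{w} (ModuleCat.{u} R)] in
lemma isLocal_homology_homFunctor_complexP (M : CochainComplex (ModuleCat.{u} R) ℤ) (n : ℤ) :
    isLocal S (((homFunctor P.complexP).obj M).homology n) := by
  let := HasDerivedCategory.standard (ModuleCat.{u} R)
  exact isLocal_homology_homFunctor _ _ S (fun s hs => isIso_smul_id_Q_complexP P hs) n

omit [HasDerivedCategory.{w} (ModuleCat.{u} R)] in
lemma isZero_homology_homFunctor_complexT {Y : CochainComplex (ModuleCat.{u} R) ℤ}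
    (hY : ∀ m, isLocal S (Y.homology m)) (n : ℤ) :
    IsZero (((homFunctor P.complexT).obj Y).homology n) := by
  let := HasDerivedCategory.standard (ModuleCat.{u} R)
  rw [isZero_homology_homFunctor_iff]
  intro f
  refine eq_zero_of_tors_of_isLocal S (fun m => ?_) (fun m => ?_) f
  · rw [prop_homologyFunctor_Q_iff (tors S)]
    exact P.tors_homology_complexT m
  · rw [prop_homologyFunctor_Q_iff (isLocal S)]
    exact isLocal_homology_shift hY n m

omit [HasDerivedCategory.{w} (ModuleCat.{u} R)] in
lemma isZero_homology_homFunctor_complexP_iff [HasProjectiveDimensionLE (loc S) 1]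
    (C : CochainComplex (ModuleCat.{u} R) ℤ) :
    (∀ n, IsZero (((homFunctor P.complexP).obj C).homology n)) ↔
      ∀ n, ctra S (C.homology n) := by
  let := HasDerivedCategory.standard (ModuleCat.{u} R)
  simp_rw [isZero_homology_homFunctor_iff, ← prop_homologyFunctor_Q_iff (ctra S)]
  rw [ctra_homology_iff, ← forall_hom_shift_eq_zero_iff (-1)]
  refine forall_congr' fun n => ?_
  -- The resolution ends in degree `1`, so it represents `S⁻¹R` shifted by `-1`.
  let e₁ : DerivedCategory.Q.obj P.complexP ≅
      ((DerivedCategory.singleFunctor (ModuleCat.{u} R) 0).obj (loc S))⟦(-1 : ℤ)⟧ :=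
    asIso (DerivedCategory.Q.map P.augP) ≪≫
      ((DerivedCategory.singleFunctors (ModuleCat.{u} R)).shiftIso (-1) 1 0 (by lia)).symm.app _
  let e₂ : DerivedCategory.Q.obj (C⟦n⟧) ≅ (DerivedCategory.Q.obj C)⟦n⟧ :=
    (DerivedCategory.Q.commShiftIso n).app C
  constructor
  · intro h f
    rw [← cancel_epi e₁.hom, ← cancel_mono e₂.inv, Category.assoc, h (e₁.hom ≫ f ≫ e₂.inv)]
    simp
  · intro h f
    rw [← cancel_epi e₁.inv, ← cancel_mono e₂.hom, Category.assoc, h (e₁.inv ≫ f ≫ e₂.hom)]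
    simp

omit [HasDerivedCategory.{w} (ModuleCat.{u} R)] in
-- Acyclicity of `Hom(P, Hom(T, M))` is needed. After exchanging the variables it follows from maps
-- out of the torsion complex `T` to the local complex `Hom(P, M)` being zero.
lemma ctra_homology_homFunctor_complexT [HasProjectiveDimensionLE (loc S) 1]
    (M : CochainComplex (ModuleCat.{u} R) ℤ) (n : ℤ) :
    ctra S (((homFunctor P.complexT).obj M).homology n) := by
  revert n
  rw [← isZero_homology_homFunctor_complexP_iff P]
  exact fun n => isZero_homology_homFunctor_homFunctor n
    (isZero_homology_homFunctor_complexT P (isLocal_homology_homFunctor_complexP P M) n)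

lemma exists_homUnit_triangle (M : CochainComplex (ModuleCat.{u} R) ℤ) :
    ∃ δ : DerivedCategory.Q.obj ((homFunctor P.complexP).obj M) ⟶
        (DerivedCategory.Q.obj M)⟦(1 : ℤ)⟧,
      Triangle.mk (DerivedCategory.Q.map ((homUnit P).app M))
        (DerivedCategory.Q.map ((homPrecomp P.inclT).app M)) δ ∈
          distTriang (DerivedCategory.{w} (ModuleCat.{u} R)) := by
  choose s r hr hs hid using P.exists_splitting
  have hS := homPrecomp_shortExact P.inclT P.projT P.inclT_projT M s r hr hs hid
  have h : DerivedCategory.Q.map ((homUnit P).app M) =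
      (DerivedCategory.Q.mapIso ((asIso (evalOne R)).symm.app M)).hom ≫
        DerivedCategory.Q.map ((homPrecomp P.projT).app M) := by
    simp [homUnit]
  rw [h]
  exact ⟨_, distinguished_of_iso_comp (DerivedCategory.triangleOfSES_distinguished hS)
    (DerivedCategory.Q.mapIso ((asIso (evalOne R)).symm.app M))⟩

lemma isIso_Q_map_homUnit_app [HasProjectiveDimensionLE (loc S) 1]
    {C : CochainComplex (ModuleCat.{u} R) ℤ} (hC : ∀ n, ctra S (C.homology n)) :
    IsIso (DerivedCategory.Q.map ((homUnit P).app C)) := by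
  obtain ⟨δ, hδ⟩ := exists_homUnit_triangle P C
  refine (Triangle.isZero₃_iff_isIso₁ _ hδ).1 ?_
  exact (isZero_Q_obj_iff _).2 ((isZero_homology_homFunctor_complexP_iff P C).2 hC)

lemma eq_zero_of_isLocal_of_ctra [HasProjectiveDimensionLE (loc S) 1]
    {X Y : DerivedCategory.{w} (ModuleCat.{u} R)}
    (hX : ∀ n, isLocal S ((DerivedCategory.homologyFunctor _ n).obj X))
    (hY : ∀ n, ctra S ((DerivedCategory.homologyFunctor _ n).obj Y)) (f : X ⟶ Y) : f = 0 := by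
  obtain ⟨P⟩ : Nonempty (LocResolution S) := inferInstance
  obtain ⟨K, ⟨eX⟩⟩ : ∃ K, Nonempty (DerivedCategory.Q.obj K ≅ X) :=
    ⟨_, ⟨DerivedCategory.Q.objObjPreimageIso X⟩⟩
  obtain ⟨L, ⟨eY⟩⟩ : ∃ K, Nonempty (DerivedCategory.Q.obj K ≅ Y) :=
    ⟨_, ⟨DerivedCategory.Q.objObjPreimageIso Y⟩⟩
  -- `homUnit` is natural for maps of complexes, so the morphism is first represented by a chain map
  -- `g` into a complex quasi-isomorphic to `L`.
  obtain ⟨L', g, t, ht, hg⟩ := DerivedCategory.left_fac (eX.hom ≫ f ≫ eY.inv)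
  have hK (n : ℤ) : isLocal S (K.homology n) := by
    rw [← prop_homologyFunctor_Q_iff (isLocal S)]
    exact (isLocal S).prop_of_iso ((DerivedCategory.homologyFunctor _ n).mapIso eX.symm) (hX n)
  have hL' (n : ℤ) : ctra S (L'.homology n) := by
    rw [← prop_homologyFunctor_Q_iff (ctra S)]
    exact (ctra S).prop_of_iso ((DerivedCategory.homologyFunctor _ n).mapIso
      (eY.symm ≪≫ asIso (DerivedCategory.Q.map t))) (hY n)
  have := isIso_Q_map_homUnit_app P hL'
  have hg₀ : DerivedCategory.Q.map g = 0 := by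
    rw [← cancel_mono (DerivedCategory.Q.map ((homUnit P).app L')), zero_comp, ← Functor.map_comp]
    have := (homUnit P).naturality g
    dsimp only [Functor.id_map] at this
    rw [this, Functor.map_comp]
    -- By naturality the composite passes through `Hom(T, K)`, which is acyclic because `K` is
    -- local.
    exact ((isZero_Q_obj_iff _).2 (isZero_homology_homFunctor_complexT P hK)).eq_zero_of_tgt
      (DerivedCategory.Q.map ((homUnit P).app K)) ▸ zero_comp
  rw [← cancel_epi eX.hom, ← cancel_mono eY.inv, Category.assoc, hg, hg₀]
  simp

/-- This allows `M` to be replaced by a strictly bounded representative `K` when estimating the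
cohomology of `Hom(X, M)`. -/
lemma isZero_homology_homFunctor_of_iso (X : CochainComplex (ModuleCat.{u} R) ℤ) [X.IsKProjective]
    {M K : CochainComplex (ModuleCat.{u} R) ℤ}
    (e : DerivedCategory.Q.obj M ≅ DerivedCategory.Q.obj K) (n : ℤ)
    (h : ∀ g : X ⟶ K⟦n⟧, g = 0) : IsZero (((homFunctor X).obj M).homology n) := by
  rw [isZero_homology_homFunctor_iff]
  intro f
  let e' : DerivedCategory.Q.obj (M⟦n⟧) ≅ DerivedCategory.Q.obj (K⟦n⟧) :=
    (DerivedCategory.Q.commShiftIso n).app M ≪≫ (CategoryTheory.shiftFunctor _ n).mapIso e ≪≫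
      (DerivedCategory.Q.commShiftIso n).symm.app K
  obtain ⟨g, hg⟩ := exists_Q_map_eq (f ≫ e'.hom)
  rw [← cancel_mono e'.hom, ← hg, h g, Functor.map_zero, zero_comp]

lemma plus_Q_homFunctor_complexT {M : CochainComplex (ModuleCat.{u} R) ℤ}
    (hM : DerivedCategory.TStructure.t.plus (DerivedCategory.Q.obj M)) :
    DerivedCategory.TStructure.t.plus
      (DerivedCategory.Q.obj ((homFunctor P.complexT).obj M)) := by
  obtain ⟨n, K, e, hK⟩ := hM
  -- A map from degree `p` to degree `q` has degree `q - p`; the term of `T` in degree `1` lowers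
  -- the bound by one.
  have : ((homFunctor P.complexT).obj M).IsGE (n - 1) := by
    rw [isGE_iff]
    intro i hi
    rw [exactAt_iff_isZero_homology]
    refine isZero_homology_homFunctor_of_iso _ e i fun g => ?_
    have := K.isStrictlyGE_shift n i (n - i) (by lia)
    ext p : 1
    by_cases hp : p ≤ 1
    · exact ((K⟦i⟧).isZero_of_isStrictlyGE (n - i) p (by lia)).eq_of_tgt _ _
    · exact (P.complexT.isZero_of_isStrictlyLE 1 p (by lia)).eq_of_src _ _
  exact ⟨n - 1, (DerivedCategory.isGE_Q_obj_iff _ (n - 1)).2 this⟩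

lemma minus_Q_homFunctor_complexT {M : CochainComplex (ModuleCat.{u} R) ℤ}
    (hM : DerivedCategory.TStructure.t.minus (DerivedCategory.Q.obj M)) :
    DerivedCategory.TStructure.t.minus
      (DerivedCategory.Q.obj ((homFunctor P.complexT).obj M)) := by
  obtain ⟨n, K, e, hK⟩ := hM
  -- No loss above, since `T` starts in degree `0`.
  have : ((homFunctor P.complexT).obj M).IsLE n := by
    rw [isLE_iff]
    intro i hi
    rw [exactAt_iff_isZero_homology]
    refine isZero_homology_homFunctor_of_iso _ e i fun g => ?_
    have := K.isStrictlyLE_shift n i (n - i) (by lia)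
    ext p : 1
    by_cases hp : 0 ≤ p
    · exact ((K⟦i⟧).isZero_of_isStrictlyLE (n - i) p (by lia)).eq_of_tgt _ _
    · exact (P.complexT.isZero_of_isStrictlyGE 0 p (by lia)).eq_of_src _ _
  exact ⟨n, (DerivedCategory.isLE_Q_obj_iff _ n).2 this⟩

lemma prop_Q_homFunctor_complexT {s : Bdd} {M : CochainComplex (ModuleCat.{u} R) ℤ}
    (hM : s.prop (DerivedCategory.Q.obj M)) :
    s.prop (DerivedCategory.Q.obj ((homFunctor P.complexT).obj M)) := by
  cases s
  · exact ⟨plus_Q_homFunctor_complexT P hM.1, minus_Q_homFunctor_complexT P hM.2⟩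
  · exact plus_Q_homFunctor_complexT P hM
  · exact minus_Q_homFunctor_complexT P hM
  · trivial

/-- The other two vertices of the cocone triangle are `M` and `S⁻¹M`, the latter in `D^⋆` by
exactness of localization and restriction. -/
lemma prop_Q_cech {s : Bdd} {M : CochainComplex (ModuleCat.{u} R) ℤ}
    (hM : s.prop (DerivedCategory.Q.obj M)) :
    s.prop (DerivedCategory.Q.obj ((cech S).obj M)) := by
  let := HasDerivedCategory.standard (ModuleCat.{u} (Localization S))
  have h := DerivedCategory.mappingCocone_triangle_distinguished ((locMap S).app M)
  refine s.prop.ext_of_isTriangulatedClosed₁ _ h hM ?_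
  let E := ModuleCat.extendScalars.{u, u, u} (algebraMap R (Localization S))
  let k := ModuleCat.restrictScalars.{u} (algebraMap R (Localization S))
  have h₁ := prop_mapDerivedCategory k s ⟨_, prop_mapDerivedCategory E s ⟨_, hM⟩⟩
  exact s.prop.prop_of_iso (k.mapDerivedCategory.mapIso (E.mapDerivedCategoryFactors.app M) ≪≫
    k.mapDerivedCategoryFactors.app _) h₁

end HomUnit

/-! ### The equivalences -/

section Localization

variable {𝒦 𝒯 𝒬 : Type*} [Category* 𝒦] [Category* 𝒯] [Category* 𝒬] {F G : 𝒦 ⥤ 𝒯}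

lemma nonempty_iso_comp_of_inverts (L : 𝒯 ⥤ 𝒬) (W : MorphismProperty 𝒯) (hL : W.IsInvertedBy L)
    (τ : F ⟶ G) (h : ∀ X, W (τ.app X)) : Nonempty (F ⋙ L ≅ G ⋙ L) :=
  ⟨NatIso.ofComponents (fun X => have := hL _ (h X); asIso (L.map (τ.app X))) fun f => by
    simp [← Functor.map_comp]⟩

end Localization

section Matlis

variable {R : Type u} [CommRing R] (S : Submonoid R) [HasDerivedCategory.{w} (ModuleCat.{u} R)]
  [HasDerivedCategory.{w'} (ModuleCat.{u} (Localization S))] (s : Bdd)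

/-- The object of `D^⋆(R)` represented by a complex. -/
noncomputable abbrev toDStar {s : Bdd} (M : CochainComplex (ModuleCat.{u} R) ℤ)
    (hM : s.prop (DerivedCategory.Q.obj M)) : DStar.{w} (ModuleCat.{u} R) s :=
  ⟨DerivedCategory.Q.obj M, hM⟩

omit [HasDerivedCategory.{w'} (ModuleCat.{u} (Localization S))] in
lemma exists_toDStar_iso {s : Bdd} (X : DStar.{w} (ModuleCat.{u} R) s) :
    ∃ (M : CochainComplex (ModuleCat.{u} R) ℤ) (hM : s.prop (DerivedCategory.Q.obj M)),
      Nonempty (toDStar M hM ≅ X) := by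
  let e := DerivedCategory.Q.objObjPreimageIso X.obj
  exact ⟨_, s.prop.prop_of_iso e.symm X.property, ⟨s.prop.isoMk e⟩⟩

variable {S s} in
lemma trW_cechι {M : CochainComplex (ModuleCat.{u} R) ℤ} (hM : s.prop (DerivedCategory.Q.obj M)) :
    (kStar.{w, w'} S s).essImage.trW (X := toDStar _ (prop_Q_cech hM)) (Y := toDStar M hM)
      (ObjectProperty.homMk (DerivedCategory.Q.map ((cechι S).app M))) :=
  trW_essImage_kStar_of_distTriang S _
    (DerivedCategory.mappingCocone_triangle_distinguished ((locMap S).app M)) (Iso.refl _)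
    fun n => (prop_homologyFunctor_Q_iff (isLocal S) _ n).2 (isLocal_homology_locFunctor S M n)

variable {S s} in
lemma trW_homUnit (P : LocResolution S) {M : CochainComplex (ModuleCat.{u} R) ℤ}
    (hM : s.prop (DerivedCategory.Q.obj M)) :
    (kStar.{w, w'} S s).essImage.trW (X := toDStar M hM)
      (Y := toDStar _ (prop_Q_homFunctor_complexT P hM))
      (ObjectProperty.homMk (DerivedCategory.Q.map ((homUnit P).app M))) := by
  obtain ⟨δ, hδ⟩ := exists_homUnit_triangle P M
  exact trW_essImage_kStar_of_distTriang S _ hδ (Iso.refl _)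
    fun n => (prop_homologyFunctor_Q_iff (isLocal S) _ n).2
      (isLocal_homology_homFunctor_complexP P M n)

instance isEquivalence_torsCoh : ((torsCoh.{w} S s).ι ⋙ toQuot.{w, w'} S s).IsEquivalence := by
  refine isEquivalence_of_le_leftOrthogonal _ _ (fun X hX Y f hY => ?_) fun X => ?_
  · rw [mem_essImage_kStar_iff] at hY
    exact s.prop.ι.map_injective (eq_zero_of_tors_of_isLocal S hX hY f.hom)
  · obtain ⟨M, hM, ⟨e⟩⟩ := exists_toDStar_iso X
    exact ⟨_, fun n => tors_homology_cech S M n, _,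
      (MorphismProperty.cancel_right_of_respectsIso _ _ e.hom).2 (trW_cechι hM)⟩

instance isEquivalence_ctraCoh [HasProjectiveDimensionLE (loc S) 1] :
    ((ctraCoh.{w} S s).ι ⋙ toQuot.{w, w'} S s).IsEquivalence := by
  obtain ⟨P⟩ : Nonempty (LocResolution S) := inferInstance
  refine isEquivalence_of_le_rightOrthogonal _ _ (fun X hX Y f hY => ?_) fun X => ?_
  · rw [mem_essImage_kStar_iff] at hY
    exact s.prop.ι.map_injective (eq_zero_of_isLocal_of_ctra hY hX f.hom)
  · obtain ⟨M, hM, ⟨e⟩⟩ := exists_toDStar_iso X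
    exact ⟨_, fun n => (prop_homologyFunctor_Q_iff (ctra S) _ n).2
      (ctra_homology_homFunctor_complexT P M n), _,
      (MorphismProperty.cancel_left_of_respectsIso _ e.inv _).2 (trW_homUnit P hM)⟩

/-- The functor `M ↦ Hom_R(T, M)` from complexes with torsion cohomology to the derived category of
complexes with contramodule cohomology. -/
noncomputable abbrev homTors [HasProjectiveDimensionLE (loc S) 1] (P : LocResolution S) :
    (complexes (torsCoh.{w} S s)).FullSubcategory ⥤ (ctraCoh.{w} S s).FullSubcategory :=
  (ctraCoh.{w} S s).lift (s.prop.lift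
    ((complexes (torsCoh.{w} S s)).ι ⋙ homFunctor P.complexT ⋙ DerivedCategory.Q)
      fun M => prop_Q_homFunctor_complexT P M.property.choose)
    fun M n => (prop_homologyFunctor_Q_iff (ctra S) _ n).2
      (ctra_homology_homFunctor_complexT P M.obj n)

/-- The functor `A ↦ (A ⟶ S⁻¹A)` from complexes with contramodule cohomology to the derived category
of complexes with torsion cohomology. -/
noncomputable abbrev cechCtra :
    (complexes (ctraCoh.{w} S s)).FullSubcategory ⥤ (torsCoh.{w} S s).FullSubcategory :=
  (torsCoh.{w} S s).lift (s.prop.lift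
    ((complexes (ctraCoh.{w} S s)).ι ⋙ cech S ⋙ DerivedCategory.Q)
      fun M => prop_Q_cech M.property.choose)
    fun M n => tors_homology_cech S M.obj n

lemma nonempty_homTors_iso [HasProjectiveDimensionLE (loc S) 1] (P : LocResolution S) :
    Nonempty (localize (torsCoh.{w} S s) ⋙ (torsCoh.{w} S s).ι ⋙ toQuot.{w, w'} S s ≅
      homTors S s P ⋙ (ctraCoh.{w} S s).ι ⋙ toQuot.{w, w'} S s) :=
  nonempty_iso_comp_of_inverts (F := localize (torsCoh.{w} S s) ⋙ (torsCoh.{w} S s).ι)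
    (G := homTors S s P ⋙ (ctraCoh.{w} S s).ι) (toQuot.{w, w'} S s) _
    (MorphismProperty.Q_inverts _)
    { app M := ObjectProperty.homMk (DerivedCategory.Q.map ((homUnit P).app M.obj))
      naturality M N f := s.prop.ι.map_injective (by
        change DerivedCategory.Q.map f.hom ≫ DerivedCategory.Q.map ((homUnit P).app N.obj) =
          DerivedCategory.Q.map ((homUnit P).app M.obj) ≫
            DerivedCategory.Q.map ((homFunctor P.complexT).map f.hom)
        rw [← Functor.map_comp, ← Functor.map_comp]
        exact congrArg _ ((homUnit P).naturality f.hom)) }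
    fun M => trW_homUnit P M.property.choose

lemma nonempty_cechCtra_iso [HasProjectiveDimensionLE (loc S) 1] :
    Nonempty (cechCtra S s ⋙ (torsCoh.{w} S s).ι ⋙ toQuot.{w, w'} S s ≅
      localize (ctraCoh.{w} S s) ⋙ (ctraCoh.{w} S s).ι ⋙ toQuot.{w, w'} S s) :=
  nonempty_iso_comp_of_inverts (F := cechCtra S s ⋙ (torsCoh.{w} S s).ι)
    (G := localize (ctraCoh.{w} S s) ⋙ (ctraCoh.{w} S s).ι) (toQuot.{w, w'} S s) _
    (MorphismProperty.Q_inverts _)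
    { app M := ObjectProperty.homMk (DerivedCategory.Q.map ((cechι S).app M.obj))
      naturality M N f := s.prop.ι.map_injective (by
        change DerivedCategory.Q.map ((cech S).map f.hom) ≫
          DerivedCategory.Q.map ((cechι S).app N.obj) =
          DerivedCategory.Q.map ((cechι S).app M.obj) ≫ DerivedCategory.Q.map f.hom
        rw [← Functor.map_comp, ← Functor.map_comp]
        exact congrArg _ ((cechι S).naturality f.hom)) }
    fun M => trW_cechι M.property.choose

end Matlis

/-! ### Identification of the equivalence and its inverse -/

section Matlis

variable {R : Type u} [CommRing R] (S : Submonoid R) [HasProjectiveDimensionLE (loc S) 1]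
    [HasDerivedCategory.{w} (ModuleCat.{u} R)]
    [HasDerivedCategory.{w'} (ModuleCat.{u} (Localization S))] (s : Bdd)

/-- Both functors become isomorphic to the same functor in the Verdier quotient, and the functor
from the contramodule side is fully faithful, hence can be cancelled. -/
lemma nonempty_localize_functor_iso (P : LocResolution S)
    (E : (torsCoh.{w} S s).FullSubcategory ≌ (ctraCoh.{w} S s).FullSubcategory)
    (e : E.functor ⋙ (ctraCoh.{w} S s).ι ⋙ toQuot.{w, w'} S s ≅
      (torsCoh.{w} S s).ι ⋙ toQuot.{w, w'} S s) :
    Nonempty (localize (torsCoh.{w} S s) ⋙ E.functor ≅ homTors S s P) := by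
  obtain ⟨i⟩ := nonempty_homTors_iso.{w, w'} S s P
  have := isEquivalence_ctraCoh.{w, w'} S s
  exact ⟨Functor.fullyFaithfulCancelRight ((ctraCoh.{w} S s).ι ⋙ toQuot.{w, w'} S s)
    (Functor.associator _ _ _ ≪≫ Functor.isoWhiskerLeft (localize (torsCoh.{w} S s)) e ≪≫ i)⟩

lemma nonempty_localize_inverse_iso
    (E : (torsCoh.{w} S s).FullSubcategory ≌ (ctraCoh.{w} S s).FullSubcategory)
    (e : E.functor ⋙ (ctraCoh.{w} S s).ι ⋙ toQuot.{w, w'} S s ≅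
      (torsCoh.{w} S s).ι ⋙ toQuot.{w, w'} S s) :
    Nonempty (localize (ctraCoh.{w} S s) ⋙ E.inverse ≅ cechCtra S s) := by
  obtain ⟨i⟩ := nonempty_cechCtra_iso.{w, w'} S s
  have := isEquivalence_torsCoh.{w, w'} S s
  let e' : E.inverse ⋙ (torsCoh.{w} S s).ι ⋙ toQuot.{w, w'} S s ≅
      (ctraCoh.{w} S s).ι ⋙ toQuot.{w, w'} S s :=
    Functor.isoWhiskerLeft E.inverse e.symm ≪≫ (Functor.associator _ _ _).symm ≪≫
      Functor.isoWhiskerRight E.counitIso _ ≪≫ Functor.leftUnitor _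
  exact ⟨Functor.fullyFaithfulCancelRight ((torsCoh.{w} S s).ι ⋙ toQuot.{w, w'} S s)
    (Functor.associator _ _ _ ≪≫ Functor.isoWhiskerLeft (localize (ctraCoh.{w} S s)) e' ≪≫
      i.symm)⟩

end Matlis

end TriangulatedMatlis

theorem mainTheorem2 {R : Type u} [CommRing R] (S : Submonoid R)
    [HasProjectiveDimensionLE (loc S) 1]
    [HasDerivedCategory.{w} (ModuleCat.{u} R)]
    [HasDerivedCategory.{w'} (ModuleCat.{u} (Localization S))] (s : Bdd) :
    ∃ _ : (kStar.{w, w'} S s).Full,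
      (kStar.{w, w'} S s).Faithful ∧
      (kStar.{w, w'} S s).IsTriangulated ∧
      (kStar.{w, w'} S s).essImage.IsTriangulated ∧
      (kStar.{w, w'} S s).essImage.IsStableUnderRetracts ∧
      ((torsCoh.{w} S s).ι ⋙ toQuot.{w, w'} S s).IsTriangulated ∧
      ((torsCoh.{w} S s).ι ⋙ toQuot.{w, w'} S s).IsEquivalence ∧
      ((ctraCoh.{w} S s).ι ⋙ toQuot.{w, w'} S s).IsTriangulated ∧
      ((ctraCoh.{w} S s).ι ⋙ toQuot.{w, w'} S s).IsEquivalence ∧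
      ∃ (E : (torsCoh.{w} S s).FullSubcategory ≌ (ctraCoh.{w} S s).FullSubcategory)
        (_ : E.functor.CommShift ℤ) (_ : E.inverse.CommShift ℤ) (_ : E.CommShift ℤ),
        E.IsTriangulated ∧
        (∃ e : E.functor ⋙ (ctraCoh.{w} S s).ι ⋙ toQuot.{w, w'} S s ≅
            (torsCoh.{w} S s).ι ⋙ toQuot.{w, w'} S s, NatTrans.CommShift e.hom ℤ) ∧
        (∀ P : LocResolution S, Nonempty
          (localize (torsCoh.{w} S s) ⋙ E.functor ⋙ (ctraCoh.{w} S s).ι ⋙ s.prop.ι ≅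
            (complexes (torsCoh.{w} S s)).ι ⋙ homFunctor P.complexT ⋙ DerivedCategory.Q)) ∧
        Nonempty
          (localize (ctraCoh.{w} S s) ⋙ E.inverse ⋙ (torsCoh.{w} S s).ι ⋙ s.prop.ι ≅
            (complexes (ctraCoh.{w} S s)).ι ⋙ cech S ⋙ DerivedCategory.Q) := by
  -- The equivalence is built without any resolution, so one `E` serves every choice of `P`.
  obtain ⟨E, h₁, h₂, h₃, h₄, e, he⟩ := exists_triangulated_equivalence
    ((torsCoh.{w} S s).ι ⋙ toQuot.{w, w'} S s) ((ctraCoh.{w} S s).ι ⋙ toQuot.{w, w'} S s)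
  refine ⟨full_kStar S s, faithful_kStar S s, inferInstance, inferInstance,
    isStableUnderRetracts_essImage_kStar S s, inferInstance, inferInstance, inferInstance,
    inferInstance, E, h₁, h₂, h₃, h₄, ⟨e, he⟩, fun P => ?_, ?_⟩
  · obtain ⟨i⟩ := nonempty_localize_functor_iso S s P E e
    exact ⟨Functor.isoWhiskerRight i ((ctraCoh.{w} S s).ι ⋙ s.prop.ι)⟩
  · obtain ⟨i⟩ := nonempty_localize_inverse_iso S s E e
    exact ⟨Functor.isoWhiskerRight i ((torsCoh.{w} S s).ι ⋙ s.prop.ι)⟩
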